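/- **Setting.** Let $E=\mathbb C^d$, $F=\mathbb C^r$ with the standard Hermitian inner products, $p\in\mathbb R^d\subset E$, and let $K_0\subset E$ be a compact neighbourhood of $0$ that is absolutely convex ($ax+by\in K_0$ for $x,y\in K_0$, $|a|+|b|\le 1$, $a,b\in\mathbb C$), with Minkowski functional $|z|_{K_0}=\inf\{t>0: z\in tK_0\}$. Put $K=p+K_0$, and let $f:K\to F$ be analytic, i.e. the restriction of a map holomorphic on an open neighbourhood of $K$. Let $K_1$ be a compact subset of the interior of $K_0$, and $R_{K_1}=\sup_{z\in K_1}|z|_{K_0}$. For $\alpha\in\mathbb Z_{\ge0}^d$ let $u_{p,\alpha}(z)=\frac{e^{-\|p\|^2/2}}{\sqrt{\alpha!}}(z-p)^\alpha e^{p^*z}$, and let $\mathbf u_{p,n}(z)$ be the row vector $(u_{p,\alpha}(z))_{|\alpha|\le n}$, of length $r_n^E=\#\{\alpha:|\alpha|\le n\}$, with the multi-indices ordered so that $|\alpha|$ is non-decreasing; define $v_{q,\beta}$ and $\mathbf v_{q,n}$ on $F$ in the same way. For $Z=(z^1,\dots,z^N)\in K^N$ let $\mathbf U_{p,n,Z}$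 be the matrix with rows $\mathbf u_{p,n}(z^k)$ and $\mathbf V_{f(p),m,W}$ the one with rows $\mathbf v_{f(p),m}(f(z^k))$. For $m\le n$ let $\widehat{\mathbf C}_{m,n,Z}$ consist of the columns with $|\alpha|\le m$ of $\mathbf V_{f(p),m,W}^*(\mathbf U_{p,n,Z}^*)^\dagger$ ($\dagger$ is the Moore–Penrose pseudo-inverse), and let $\widetilde f_{m,n,Z}:E\to F$ have the components $$\widetilde f_{m,n,Z,i}(z)=\mathbf u_{p,m}(z)\,\widehat{\mathbf C}_{m,n,Z}^*\,\bigl(\partial_i\mathbf v_{f(p),m}(0)\bigr)^*,\qquad i=1,\dots,r.$$ For a finite Borel measure $\mu$ on $K_0$ let $\mathbf D_n(\mu)=\bigl(\int \overline{x}^{\,\alpha}x^{\beta}\,d\mu(x)\bigr)_{|\alpha|,|\beta|\le n}$ (for $\mu$ carried by $\mathbb R^d$ this is the Hankel moment matrix $\bigl(\int x^{\alpha+\beta}d\mu\bigr)$), let $\Lambda_n(\mu)$ be its smallest eigenvalue, $R_\mu=\sup_{x\in\operatorname{supp}\mu}|x|_{K_0}$, and $L_\mu=\max\bigl(1,\sup_{z\in\operatorname{supp}\mu}\max_i|z_i|\bigr)$.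 For points $z_0^1,z_0^2,\dots\in K_0$ put $\widehat\mu_N=N^{-1}\sum_{k=1}^N\delta_{z_0^k}$ and $Z_N=(p+z_0^1,\dots,p+z_0^N)$. For $m=0$ read $(m-1)!$ as $1$; $0^0=1$. **Theorem.** (1) Let $\mu$ be a finite Borel measure on $K_0$ whose support lies in the interior of $K_0$. There is a constant $C'>0$, depending only on $f,p,K_0,K_1,\mu$, such that the following holds for all integers $0\le m\le n$, all $N$, all $z_0^1,\dots,z_0^N\in\operatorname{supp}\mu$ and all $\gamma\in(0,1)$: if $\mathbf D_n(\mu)$ is invertible and $$\bigl\|\mathbf I-\mathbf D_n(\mu)^{-1/2}\mathbf D_n(\widehat\mu_N)\mathbf D_n(\mu)^{-1/2}\bigr\|_{\rm op}\le 1-\gamma,$$ then $$\sup_{z\in p+K_1}\bigl\|\widetilde f_{m,n,Z_N}(z)-f(z)\bigr\|\le C'\left(\frac{\|f(p)\|^m}{\sqrt{(m-1)!}}+\sqrt{\frac{m!}{\gamma}}\,\frac{R_\mu^n}{\Lambda_n(\mu)^{1/2}}+R_{K_1}^m\right).$$ (2) Let $\mu$ be a Borel probability measure on $K_0\cap\mathbb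 R^d$ that is absolutely continuous with respect to Lebesgue measure on $\mathbb R^d$. There is a constant $C>0$, depending only on $f,p,K_0,K_1,\mu$, such that for all integers $0\le m\le n$: (a) if $(z_0^k)_{k\ge1}\subset K_0$ and $\widehat\mu_N\to\mu$ weakly as $N\to\infty$, then $$\limsup_{N\to\infty}\sup_{z\in p+K_1}\bigl\|\widetilde f_{m,n,Z_N}(z)-f(z)\bigr\|\le C\left(\frac{\|f(p)\|^m}{\sqrt{(m-1)!}}+\sqrt{m!}\,\frac{R_\mu^n}{\Lambda_n(\mu)^{1/2}}+R_{K_1}^m\right);$$ (b) if $\delta\in(0,1)$, if $$N\ge\frac{L_\mu^{4n}(r_n^E)^2}{\Lambda_n(\mu)^2}\cdot4\log(2/\delta),$$ and if $z_0^1,\dots,z_0^N$ are i.i.d. random variables with law $\mu$, then with probability at least $1-\delta$ $$\sup_{z\in p+K_1}\bigl\|\widetilde f_{m,n,Z_N}(z)-f(z)\bigr\|\le C\left(\frac{\|f(p)\|^m}{\sqrt{(m-1)!}}+\sqrt{m!}\,\frac{R_\mu^n}{\Lambda_n(\mu)^{1/2}}+R_{K_1}^m\right).$$ -/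

import Mathlib

open MeasureTheory ProbabilityTheory Filter Topology
open scoped ENNReal Matrix ComplexConjugate

noncomputable section

namespace FockRegression

/-- `ℂ^d` with its standard Hermitian inner product. -/
abbrev Cn (d : ℕ) : Type := EuclideanSpace ℂ (Fin d)

/-- Multi-indices `α ∈ ℕ^d` of length `|α| ≤ n`. They index the rows and columns of all matrices
below; a graded numbering of `ℕ^d` lists those of length `≤ m` before the others. -/
abbrev MultiIndex (d n : ℕ) : Type := {α : Fin d → ℕ // ∑ i, α i ≤ n}

instance (d n : ℕ) : Finite (MultiIndex d n) := by
  have h : ∀ (α : MultiIndex d n) (i : Fin d), α.1 i < n + 1 := fun α i =>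
    Nat.lt_succ_of_le ((Finset.single_le_sum (f := α.1) (fun _ _ => Nat.zero_le _)
      (Finset.mem_univ i)).trans α.2)
  refine Finite.of_injective (fun (α : MultiIndex d n) (i : Fin d) => (⟨α.1 i, h α i⟩ : Fin (n + 1)))
    fun α β hαβ => Subtype.ext (funext fun i => ?_)
  exact congrArg Fin.val (congrFun hαβ i)

instance (d n : ℕ) : Fintype (MultiIndex d n) := Fintype.ofFinite _

/-- Multi-indices of length `≤ m` among those of length `≤ n`. -/
def MultiIndex.incl {d m n : ℕ} (h : m ≤ n) (α : MultiIndex d m) : MultiIndex d n :=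
  ⟨α.1, α.2.trans h⟩

/-- `z^α = ∏ᵢ zᵢ^{αᵢ}`. -/
def monomial {d : ℕ} (z : Cn d) (α : Fin d → ℕ) : ℂ := ∏ i, z i ^ α i

/-- `u_{p,α}(z) = e^{-‖p‖²/2} / √(α!) · (z - p)^α · e^{p^* z}` (`inner ℂ p z = p^* z = ∑ conj(pᵢ) zᵢ`).
For the target space `ℂ^r` these are the functions `v_{q,β}`. -/
def fockFun {d : ℕ} (p : Cn d) (α : Fin d → ℕ) (z : Cn d) : ℂ :=
  (Real.exp (-‖p‖ ^ 2 / 2) / Real.sqrt ((∏ i, (α i).factorial : ℕ) : ℝ) : ℝ) *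
    monomial (z - p) α * Complex.exp (inner ℂ p z)

/-- The vector `𝐮_{p,n}(z)` of all `u_{p,α}(z)` with `|α| ≤ n`. -/
def fockVec {d : ℕ} (p : Cn d) (n : ℕ) (z : Cn d) : MultiIndex d n → ℂ :=
  fun α => fockFun p α.1 z

/-- The matrix `𝐔_{p,n,Z}` whose `k`-th row is `𝐮_{p,n}(z^k)`. -/
def fockMatrix {d N : ℕ} (p : Cn d) (n : ℕ) (Z : Fin N → Cn d) :
    Matrix (Fin N) (MultiIndex d n) ℂ :=
  Matrix.of fun k => fockVec p n (Z k)

/-- The Moore--Penrose pseudo-inverse `A^† = (A^* A)^† A^*`, where the pseudo-inverse of the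
Hermitian matrix `A^* A` inverts its non-zero eigenvalues (`0⁻¹ = 0` in `ℝ`). -/
def pinv {κ ι : Type*} [Fintype κ] [Fintype ι] [DecidableEq ι] (A : Matrix κ ι ℂ) :
    Matrix ι κ ℂ :=
  cfc (fun t : ℝ => t⁻¹) (Aᴴ * A) * Aᴴ

/-- The four Penrose equations, which characterize the pseudo-inverse. -/
theorem pinv_spec {κ ι : Type*} [Fintype κ] [Fintype ι] [DecidableEq ι] (A : Matrix κ ι ℂ) :
    A * pinv A * A = A ∧ pinv A * A * pinv A = pinv A ∧
      (A * pinv A)ᴴ = A * pinv A ∧ (pinv A * A)ᴴ = pinv A * A := by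
  have hG : IsSelfAdjoint (Aᴴ * A) := Matrix.isHermitian_conjTranspose_mul_self A
  set G := Aᴴ * A with hGdef
  set H := cfc (fun t : ℝ => t⁻¹) G with hH
  have hc : ∀ g : ℝ → ℝ, ContinuousOn g (spectrum ℝ G) := fun g =>
    Matrix.finite_real_spectrum.continuousOn g
  have hsa : Hᴴ = H := (cfc_predicate (fun t : ℝ => t⁻¹) G : IsSelfAdjoint H)
  have hid : cfc (fun t : ℝ => t) G = G := cfc_id' ℝ G
  have hHG : H * G = cfc (fun t : ℝ => t⁻¹ * t) G := by
    rw [cfc_mul _ _ G (hc _) (hc _), hid]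
  have hGH : G * H = cfc (fun t : ℝ => t⁻¹ * t) G := by
    rw [show (fun t : ℝ => t⁻¹ * t) = fun t : ℝ => t * t⁻¹ from funext fun t => mul_comm _ _,
      cfc_mul _ _ G (hc _) (hc _), hid]
  have hGHG : G * (H * G) = G := by
    have h := cfc_mul (fun t : ℝ => t) (fun t : ℝ => t⁻¹ * t) G (hc _) (hc _)
    rw [← hHG, hid] at h
    rw [← h]
    conv_rhs => rw [← hid]
    exact congrArg (fun g : ℝ → ℝ => cfc g G)
      (funext fun t => by by_cases ht : t = 0 <;> simp [ht])
  have hHGH : H * G * H = H := by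
    rw [hHG, hH, ← cfc_mul _ _ G (hc _) (hc _)]
    exact congrArg (fun g : ℝ → ℝ => cfc g G)
      (funext fun t => by by_cases ht : t = 0 <;> simp [ht])
  have hp : pinv A = H * Aᴴ := rfl
  refine ⟨?_, ?_, ?_, ?_⟩
  · have h0 : (A * (H * G - 1))ᴴ * (A * (H * G - 1)) = 0 := by
      rw [Matrix.conjTranspose_mul, Matrix.mul_assoc, ← Matrix.mul_assoc Aᴴ A, ← hGdef,
        Matrix.mul_sub, hGHG, Matrix.mul_one, sub_self, Matrix.mul_zero]
    have h1 : A * (H * G - 1) = 0 := by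
      open scoped ComplexOrder in exact Matrix.conjTranspose_mul_self_eq_zero.1 h0
    rw [Matrix.mul_sub, Matrix.mul_one, sub_eq_zero] at h1
    rw [hp, Matrix.mul_assoc, Matrix.mul_assoc H, ← hGdef, h1]
  · rw [hp, Matrix.mul_assoc H Aᴴ A, ← hGdef, ← Matrix.mul_assoc, hHGH]
  · rw [hp, Matrix.conjTranspose_mul, Matrix.conjTranspose_mul, hsa, Matrix.conjTranspose_conjTranspose,
      Matrix.mul_assoc]
  · rw [hp, Matrix.mul_assoc H Aᴴ A, ← hGdef, Matrix.conjTranspose_mul, hsa,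
      show Gᴴ = G from hG, hGH, hHG]

/-- `Ĉ_{m,n,Z}`: the columns `|α| ≤ m` of `𝐕_{f(p),m,W}^* (𝐔_{p,n,Z}^*)^†`, where `W = f(Z)`. -/
def empMatrix {d r N m n : ℕ} (h : m ≤ n) (p : Cn d) (f : Cn d → Cn r) (Z : Fin N → Cn d) :
    Matrix (MultiIndex r m) (MultiIndex d m) ℂ :=
  ((fockMatrix (f p) m (fun k => f (Z k)))ᴴ * pinv (fockMatrix p n Z)ᴴ).submatrix
    id (MultiIndex.incl h)

/-- The reconstructed map `f̃_{m,n,Z} : ℂ^d → ℂ^r`, with components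
`f̃ᵢ(z) = 𝐮_{p,m}(z) Ĉ_{m,n,Z}^* (∂ᵢ 𝐯_{f(p),m}(0))^*`. -/
def reconstruction {d r N m n : ℕ} (h : m ≤ n) (p : Cn d) (f : Cn d → Cn r)
    (Z : Fin N → Cn d) (z : Cn d) : Cn r :=
  WithLp.toLp 2 fun i =>
    fockVec p m z ⬝ᵥ ((empMatrix h p f Z)ᴴ *ᵥ
      star (fun β : MultiIndex r m =>
        lineDeriv ℂ (fockFun (f p) β.1) 0 (EuclideanSpace.single i (1 : ℂ))))

/-- `sup_{z ∈ S} ‖g z - f z‖`, as an extended non-negative real. -/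
def uniformError {d r : ℕ} (g f : Cn d → Cn r) (S : Set (Cn d)) : ℝ≥0∞ :=
  ⨆ z ∈ S, ‖g z - f z‖ₑ

/-- The moment matrix `𝐃_n(μ)`, with entries `∫ conj(x)^α x^β dμ(x)`. -/
def momentMatrix {d : ℕ} (n : ℕ) (μ : Measure (Cn d)) :
    Matrix (MultiIndex d n) (MultiIndex d n) ℂ :=
  Matrix.of fun α β => ∫ x, conj (monomial x α.1) * monomial x β.1 ∂μ

/-- If `μ` lives on `ℝ^d`, then `𝐃_n(μ)` is the Hankel matrix with entries `∫ x^{α+β} dμ(x)`. -/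
theorem momentMatrix_apply_of_real {d n : ℕ} {μ : Measure (Cn d)}
    (hμ : ∀ᵐ x ∂μ, ∀ i, (x i).im = 0) (α β : MultiIndex d n) :
    momentMatrix n μ α β = ∫ x, monomial x (α.1 + β.1) ∂μ := by
  refine integral_congr_ae (hμ.mono fun x hx => ?_)
  have h : ∀ i, conj (x i) = x i := fun i => Complex.conj_eq_iff_im.2 (hx i)
  simp [monomial, map_prod, h, pow_add, Finset.prod_mul_distrib]

theorem momentMatrix_isHermitian {d : ℕ} (n : ℕ) (μ : Measure (Cn d)) :
    (momentMatrix n μ).IsHermitian := by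
  ext α β
  simp only [momentMatrix, Matrix.conjTranspose_apply, Matrix.of_apply, RCLike.star_def]
  rw [← integral_conj]
  simp [mul_comm]

/-- `Λ_n(μ)`, the smallest eigenvalue of `𝐃_n(μ)`. -/
def smallestEigenvalue {d : ℕ} (n : ℕ) (μ : Measure (Cn d)) : ℝ :=
  ⨅ α, (momentMatrix_isHermitian n μ).eigenvalues α

/-- `A^{-1/2}` of a positive definite matrix `A`, by the functional calculus. -/
def invSqrt {ι : Type*} [Fintype ι] [DecidableEq ι] (A : Matrix ι ι ℂ) : Matrix ι ι ℂ :=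
  cfc (fun t : ℝ => (Real.sqrt t)⁻¹) A

/-- The operator norm for the Euclidean norm on `ℂ^ι`. -/
def opNorm {ι : Type*} [Fintype ι] [DecidableEq ι] (A : Matrix ι ι ℂ) : ℝ :=
  ‖Matrix.toEuclideanCLM (n := ι) (𝕜 := ℂ) A‖

/-- The empirical measure `N⁻¹ ∑ₖ δ_{z^k}`. -/
def empiricalMeasure {d N : ℕ} (z : Fin N → Cn d) : Measure (Cn d) :=
  (N : ℝ≥0∞)⁻¹ • ∑ k, Measure.dirac (z k)

/-- `K` is a compact absolutely convex neighbourhood of `0` in `ℂ^d`. -/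
structure IsAbsConvexCompactNhd {d : ℕ} (K : Set (Cn d)) : Prop where
  isCompact : IsCompact K
  mem_nhds : K ∈ 𝓝 (0 : Cn d)
  absConvex : ∀ x ∈ K, ∀ y ∈ K, ∀ a b : ℂ, ‖a‖ + ‖b‖ ≤ 1 → a • x + b • y ∈ K

/-- `sup_{x ∈ S} |x|_K`, where `|x|_K = inf {r > 0 : x ∈ r K}` is the Minkowski functional. -/
def radius {d : ℕ} (K S : Set (Cn d)) : ℝ := sSup (gauge K '' S)

/-- `L_μ = max (1, sup_{z ∈ supp μ} maxᵢ |zᵢ|)`; the norm on `Fin d → ℂ` is the maximum norm. -/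
def coordBound {d : ℕ} (μ : Measure (Cn d)) : ℝ :=
  max 1 (sSup ((fun z : Cn d => ‖(WithLp.ofLp z : Fin d → ℂ)‖) '' μ.support))

/-- The inclusion `ℝ^d ⊆ ℂ^d`. -/
def ofRealVec {d : ℕ} (x : EuclideanSpace ℝ (Fin d)) : Cn d :=
  WithLp.toLp 2 fun i => (x i : ℂ)

/-- The translate `p + S`. -/
def translateSet {d : ℕ} (p : Cn d) (S : Set (Cn d)) : Set (Cn d) := (fun z => p + z) '' S

end FockRegression

end

open FockRegression

noncomputable section

namespace FockRegression

/-! ### Multi-indices -/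

/-! Put z = p + x. Then u_{p,α}(p + x) = w(x) x^α / √(α!), where w = `fockWeight p` has no zeros, so
after division by w the problem is polynomial approximation in x. By `reconstruction_apply`,
component i of the reconstruction is the least-squares fit of degree ≤ n to the sampled values of
g(x) = `coordApprox (f p) m i` at f(p + x), with only the coefficients of degree ≤ m kept. Here
`coordApprox q m i` is the Fock space projection of the i-th coordinate function on the span of the
v_{q,β}, |β| ≤ m. It agrees with that coordinate to order m + 1 at q (`coordApprox_sub_isBigO`), and
it is bounded on bounded sets uniformly in m (`norm_coordApprox_le`).

Hence φ = g/w and ψ = f_i/w have the same Taylor polynomial of degree m at x = 0. If the sample has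
a lower frame bound c > 0 (`IsStableSample`), the fit reproduces the degree n Taylor polynomial of φ
exactly, and only its remainder at the samples, O(|x|_{K₀}^n), passes through the pseudo-inverse, at
a cost of order √(m!/c). The kept part of the polynomial is the Taylor polynomial of ψ, with
remainder O(R_{K₁}^m) on K₁. Both remainders come from Cauchy estimates on complex lines inside a
dilate ρK₀, ρ > 1, over which f is still analytic. This gives `exists_uniformError_bound`; the
summand ‖f(p)‖^m/√((m-1)!) is not needed for it.

It remains to find c. The operator norm condition gives c = γΛ. Weak convergence makes the moment
matrices converge, so eventually c = Λ/2 works. For i.i.d. samples, Hoeffding's inequality in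
Hilbert space (`measure_norm_sum_ge_le`) is applied to the moment matrices in Frobenius norm. With
the prescribed N this leaves a positive c only if the squared radius of the centred matrices is
below 2 r_n² L^{4n} by a factor independent of n. Absolute continuity supplies that factor through
`relativeMean_lt_one` and `norm_momentVec_sub_sq_le`. -/

lemma sum_multiIndex {d n : ℕ} {M : Type*} [AddCommMonoid M] (F : (Fin d → ℕ) → M) :
    ∑ α : MultiIndex d n, F α.1 =
      ∑ k ∈ Finset.range (n + 1), ∑ α ∈ Finset.piAntidiag Finset.univ k, F α := by
  rw [← Finset.sum_biUnion]
  · refine (Finset.sum_subtype _ (fun α => ?_) F).symm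
    simp
  · intro k _ l _ hkl
    refine Finset.disjoint_left.2 fun α h1 h2 => hkl ?_
    simp only [Finset.mem_piAntidiag] at h1 h2
    exact h1.1.symm.trans h2.1

/-- Expand x in the standard basis and group the index words by how often each letter occurs. A word
with count α has length |α|, so a single family `a` serves all degrees. -/
lemma exists_monomial_expansion {d : ℕ} (q : FormalMultilinearSeries ℂ (Cn d) ℂ) :
    ∃ a : (Fin d → ℕ) → ℂ, ∀ (k : ℕ) (x : Cn d),
      q k (fun _ => x) = ∑ α ∈ Finset.piAntidiag Finset.univ k, a α * monomial x α := by
  classical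
  let e : Fin d → Cn d := fun i => EuclideanSpace.single i 1
  let cnt : {k : ℕ} → (Fin k → Fin d) → Fin d → ℕ :=
    fun r i => (Finset.univ.filter fun j => r j = i).card
  refine ⟨fun α => ∑ r : Fin (∑ i, α i) → Fin d, if cnt r = α then q _ (fun j => e (r j)) else 0,
    fun k x => ?_⟩
  have hx : x = ∑ i, x i • e i := by
    ext j
    simp [e, Finset.sum_apply, Pi.single_apply]
  have h1 : q k (fun _ => x) = ∑ r : Fin k → Fin d, (∏ j, x (r j)) * q k (fun j => e (r j)) := by
    conv_lhs => rw [hx]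
    have := (q k).toMultilinearMap.map_sum (fun (_ : Fin k) i => x i • e i)
    refine this.trans (Finset.sum_congr rfl fun r _ => ?_)
    exact (q k).map_smul_univ (fun j => x (r j)) fun j => e (r j)
  have h2 : ∀ r : Fin k → Fin d, ∏ j, x (r j) = monomial x (cnt r) := fun r => by
    rw [monomial, ← Finset.prod_fiberwise_of_maps_to (g := r) (t := Finset.univ) (by simp)]
    refine Finset.prod_congr rfl fun i _ => ?_
    rw [Finset.prod_congr rfl (g := fun _ => x i)
      (fun j hj => by rw [(Finset.mem_filter.1 hj).2]), Finset.prod_const]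
  have h3 : ∀ r : Fin k → Fin d, cnt r ∈ Finset.piAntidiag Finset.univ k := fun r => by
    simp only [Finset.mem_piAntidiag, cnt, Finset.mem_univ, implies_true, and_true]
    rw [← Finset.card_eq_sum_card_fiberwise (f := r) (t := Finset.univ) (by simp)]
    simp
  rw [h1, ← Finset.sum_fiberwise_of_maps_to (g := fun r : Fin k → Fin d => cnt r)
    (t := Finset.piAntidiag Finset.univ k) (fun r _ => h3 r)]
  refine Finset.sum_congr rfl fun α hα => ?_
  have hk : ∑ i, α i = k := (Finset.mem_piAntidiag.1 hα).1
  subst hk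
  rw [Finset.sum_mul, Finset.sum_filter]
  refine Finset.sum_congr rfl fun r _ => ?_
  split_ifs with h
  · rw [h2, h, mul_comm]
  · simp

/-! ### Taylor coefficients along complex lines -/

/-- The homogeneous part of degree `k` of the Taylor series of `φ` at `0`, evaluated at `x`. -/
def homPart {d : ℕ} (φ : Cn d → ℂ) (k : ℕ) (x : Cn d) : ℂ :=
  (k.factorial : ℂ)⁻¹ * iteratedDeriv k (fun t : ℂ => φ (t • x)) 0

lemma analyticAt_slice {d : ℕ} {φ : Cn d → ℂ} {x : Cn d} {t : ℂ} (h : AnalyticAt ℂ φ (t • x)) :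
    AnalyticAt ℂ (fun t : ℂ => φ (t • x)) t :=
  AnalyticAt.fun_comp (g := φ) h (by fun_prop)

lemma homPart_eq {d : ℕ} {φ : Cn d → ℂ} {q : FormalMultilinearSeries ℂ (Cn d) ℂ}
    (h : HasFPowerSeriesAt φ q 0) (k : ℕ) (x : Cn d) : homPart φ k x = q k (fun _ => x) := by
  let u : ℂ →L[ℂ] Cn d := ContinuousLinearMap.toSpanSingleton ℂ x
  have h0 : HasFPowerSeriesAt φ q (u 0) := by simpa using h
  have h1 : HasFPowerSeriesAt (fun t : ℂ => φ (t • x)) (q.compContinuousLinearMap u) 0 :=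
    h0.compContinuousLinearMap
  have h2 := (analyticAt_slice (φ := φ) (x := x) (t := 0) (by simpa using h.analyticAt)).hasFPowerSeriesAt
  have h3 := congrArg (fun s => s.coeff k) (h2.eq_formalMultilinearSeries h1)
  simp only [FormalMultilinearSeries.coeff_ofScalars] at h3
  rw [homPart, mul_comm, ← div_eq_mul_inv, h3]
  simp [FormalMultilinearSeries.coeff, FormalMultilinearSeries.compContinuousLinearMap, u]

lemma exists_taylor_monomials {d : ℕ} {φ : Cn d → ℂ} (h : AnalyticAt ℂ φ 0) :
    ∃ a : (Fin d → ℕ) → ℂ, ∀ (n : ℕ) (x : Cn d),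
      ∑ k ∈ Finset.range (n + 1), homPart φ k x = ∑ α : MultiIndex d n, a α.1 * monomial x α.1 := by
  obtain ⟨q, hq⟩ := h
  obtain ⟨a, ha⟩ := exists_monomial_expansion q
  refine ⟨a, fun n x => ?_⟩
  rw [sum_multiIndex (fun α => a α * monomial x α)]
  exact Finset.sum_congr rfl fun k _ => by rw [homPart_eq hq, ha]

/-- Were the order N of the zero at most m, the factor g in h = t^N g would be O(|t|^(m+1-N)),
contradicting g(0) ≠ 0. -/
lemma iteratedDeriv_eq_zero_of_isBigO {h : ℂ → ℂ} {m : ℕ} (ha : AnalyticAt ℂ h 0)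
    (hO : h =O[𝓝 0] fun t => ‖t‖ ^ (m + 1)) : ∀ k ≤ m, iteratedDeriv k h 0 = 0 := by
  suffices H : ((m + 1 : ℕ) : ℕ∞) ≤ analyticOrderAt h 0 by
    intro k hk
    exact (natCast_le_analyticOrderAt_iff_iteratedDeriv_eq_zero ha).1 H k (Nat.lt_succ_of_le hk)
  by_contra! hlt
  obtain ⟨N, hN⟩ := ENat.ne_top_iff_exists.1 (ne_top_of_lt hlt)
  rw [← hN] at hlt
  have hNm : N ≤ m := Nat.lt_succ_iff.1 (by exact_mod_cast hlt)
  obtain ⟨g, hg, hg0, hfg⟩ := ha.analyticOrderAt_eq_natCast.1 hN.symm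
  obtain ⟨c, hc⟩ := hO.bound
  have hev : ∀ᶠ t in 𝓝[≠] (0 : ℂ), ‖g t‖ ≤ c * ‖t‖ ^ (m + 1 - N) := by
    filter_upwards [nhdsWithin_le_nhds hc, nhdsWithin_le_nhds hfg, self_mem_nhdsWithin]
      with t h1 h2 h3
    have ht : 0 < ‖t‖ := norm_pos_iff.2 h3
    rw [h2] at h1
    simp only [sub_zero, smul_eq_mul, norm_mul, norm_pow, norm_norm] at h1
    have hs : ‖t‖ ^ (m + 1) = ‖t‖ ^ N * ‖t‖ ^ (m + 1 - N) := by
      rw [← pow_add]; congr 1; omega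
    rw [hs] at h1
    refine le_of_mul_le_mul_left ?_ (pow_pos ht N)
    linarith
  have l1 : Tendsto (fun t => ‖g t‖) (𝓝[≠] (0 : ℂ)) (𝓝 ‖g 0‖) :=
    (hg.continuousAt.norm).tendsto.mono_left nhdsWithin_le_nhds
  have l2 : Tendsto (fun t : ℂ => c * ‖t‖ ^ (m + 1 - N)) (𝓝[≠] (0 : ℂ)) (𝓝 0) := by
    have : Continuous fun t : ℂ => c * ‖t‖ ^ (m + 1 - N) := by fun_prop
    have h0 := this.tendsto 0
    simp only [norm_zero] at h0
    rw [zero_pow (by omega), mul_zero] at h0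
    exact h0.mono_left nhdsWithin_le_nhds
  exact hg0 (norm_le_zero_iff.1 (le_of_tendsto_of_tendsto l1 l2 hev))

lemma homPart_congr_of_isBigO {d m : ℕ} {φ ψ : Cn d → ℂ} (hφ : AnalyticAt ℂ φ 0)
    (hψ : AnalyticAt ℂ ψ 0) (hO : (fun x => φ x - ψ x) =O[𝓝 0] fun x => ‖x‖ ^ (m + 1))
    {k : ℕ} (hk : k ≤ m) (x : Cn d) : homPart φ k x = homPart ψ k x := by
  have aφ := analyticAt_slice (φ := φ) (x := x) (t := 0) (by simpa using hφ)
  have aψ := analyticAt_slice (φ := ψ) (x := x) (t := 0) (by simpa using hψ)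
  have hc : Tendsto (fun t : ℂ => t • x) (𝓝 0) (𝓝 0) := by
    have : Continuous fun t : ℂ => t • x := by fun_prop
    simpa using this.tendsto 0
  have h1 : (fun t : ℂ => φ (t • x) - ψ (t • x)) =O[𝓝 0] fun t => ‖t‖ ^ (m + 1) := by
    refine (hO.comp_tendsto hc).trans ?_
    refine Asymptotics.IsBigO.of_bound (‖x‖ ^ (m + 1)) (Eventually.of_forall fun t => ?_)
    simp [norm_smul, mul_pow, mul_comm]
  have h2 := iteratedDeriv_eq_zero_of_isBigO (aφ.fun_sub aψ) h1 k hk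
  rw [iteratedDeriv_fun_sub aφ.contDiffAt aψ.contDiffAt, sub_eq_zero] at h2
  rw [homPart, homPart, h2]

/-! ### Absolutely convex sets -/

namespace IsAbsConvexCompactNhd

variable {d : ℕ} {K : Set (Cn d)}

lemma zero_mem (hK : IsAbsConvexCompactNhd K) : (0 : Cn d) ∈ K := mem_of_mem_nhds hK.mem_nhds

lemma smul_mem (hK : IsAbsConvexCompactNhd K) {x : Cn d} (hx : x ∈ K) {a : ℂ} (ha : ‖a‖ ≤ 1) :
    a • x ∈ K := by
  simpa using hK.absConvex x hx x hx a 0 (by simpa using ha)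

lemma convex (hK : IsAbsConvexCompactNhd K) : Convex ℝ K := by
  intro x hx y hy a b ha hb hab
  have := hK.absConvex x hx y hy a b (by simp [abs_of_nonneg ha, abs_of_nonneg hb, hab])
  simpa using this

lemma absorbent (hK : IsAbsConvexCompactNhd K) : Absorbent ℝ K := absorbent_nhds_zero hK.mem_nhds

lemma gauge_le_one (_ : IsAbsConvexCompactNhd K) {x : Cn d} (hx : x ∈ K) : gauge K x ≤ 1 :=
  gauge_le_one_of_mem hx

lemma continuous_gauge (hK : IsAbsConvexCompactNhd K) : Continuous (gauge K) :=
  _root_.continuous_gauge hK.convex hK.mem_nhds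

lemma bddAbove_gauge (hK : IsAbsConvexCompactNhd K) {S : Set (Cn d)} (hS : S ⊆ K) :
    BddAbove (gauge K '' S) :=
  ⟨1, by rintro _ ⟨x, hx, rfl⟩; exact hK.gauge_le_one (hS hx)⟩

lemma gauge_le_radius (hK : IsAbsConvexCompactNhd K) {S : Set (Cn d)} (hS : S ⊆ K) {x : Cn d}
    (hx : x ∈ S) : gauge K x ≤ radius K S :=
  le_csSup (hK.bddAbove_gauge hS) ⟨x, hx, rfl⟩

lemma radius_nonneg (_ : IsAbsConvexCompactNhd K) (S : Set (Cn d)) : 0 ≤ radius K S :=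
  Real.sSup_nonneg (by rintro _ ⟨x, _, rfl⟩; exact gauge_nonneg x)

/-- This is where complex balancedness enters: the whole disc |t| ≤ ρ/b of the line through x stays
in ρK, so one-variable Cauchy estimates apply there. -/
lemma slice_bound (hK : IsAbsConvexCompactNhd K) {ρ : ℝ} (hρ : 0 < ρ) {x : Cn d} {b : ℝ}
    (hb : 0 < b) (hx : ∃ y ∈ K, b • y = x) {t : ℂ} (ht : ‖t‖ ≤ ρ / b) :
    ∃ y ∈ K, t • x = (ρ : ℂ) • y := by
  obtain ⟨y, hy, rfl⟩ := hx
  refine ⟨(t * b / ρ) • y, hK.smul_mem hy ?_, ?_⟩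
  · rw [norm_div, norm_mul, Complex.norm_real, Complex.norm_real, Real.norm_of_nonneg hb.le,
      Real.norm_of_nonneg hρ.le, div_le_one hρ]
    rwa [le_div_iff₀ hb] at ht
  · rw [smul_smul, mul_div_cancel₀ _ (by exact_mod_cast hρ.ne'), ← smul_smul]
    simp

lemma norm_homPart_le (hK : IsAbsConvexCompactNhd K) {ρ : ℝ} (hρ : 0 < ρ) {φ : Cn d → ℂ}
    (hφ : ∀ y ∈ K, AnalyticAt ℂ φ ((ρ : ℂ) • y)) {M : ℝ} (hM : ∀ y ∈ K, ‖φ ((ρ : ℂ) • y)‖ ≤ M)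
    (k : ℕ) (x : Cn d) : ‖homPart φ k x‖ ≤ M * (gauge K x / ρ) ^ k := by
  -- The gauge is an infimum, so the estimate is made for every R' above it and R' then tends to it.
  have key : ∀ R' > gauge K x, ‖homPart φ k x‖ ≤ M * (R' / ρ) ^ k := by
    intro R' hR'
    obtain ⟨b, hb, hbR, hx⟩ := exists_lt_of_gauge_lt hK.absorbent hR'
    have hd : DiffContOnCl ℂ (fun t : ℂ => φ (t • x)) (Metric.ball 0 (ρ / b)) := by
      refine DifferentiableOn.diffContOnCl fun t ht => ?_
      have ht' := Metric.closure_ball_subset_closedBall ht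
      rw [mem_closedBall_zero_iff] at ht'
      obtain ⟨y, hy, he⟩ := hK.slice_bound hρ hb hx ht'
      exact (analyticAt_slice (by rw [he]; exact hφ y hy)).differentiableAt.differentiableWithinAt
    have h1 := Complex.norm_iteratedDeriv_le_of_forall_mem_sphere_norm_le (C := M) k
      (div_pos hρ hb) hd fun t ht => by
        obtain ⟨y, hy, he⟩ := hK.slice_bound hρ hb hx (mem_sphere_zero_iff_norm.1 ht).le
        rw [he]; exact hM y hy
    have hM0 : 0 ≤ M := (norm_nonneg _).trans (hM 0 hK.zero_mem)
    have hk : (0 : ℝ) < k.factorial := by exact_mod_cast k.factorial_pos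
    calc ‖homPart φ k x‖ = (k.factorial : ℝ)⁻¹ * ‖iteratedDeriv k (fun t : ℂ => φ (t • x)) 0‖ := by
          simp [homPart]
      _ ≤ (k.factorial : ℝ)⁻¹ * (k.factorial * M / (ρ / b) ^ k) := by gcongr
      _ = M * (b / ρ) ^ k := by
          rw [div_pow, div_pow]; field_simp
      _ ≤ M * (R' / ρ) ^ k := by gcongr
  have l : Tendsto (fun R' : ℝ => M * (R' / ρ) ^ k) (𝓝[>] (gauge K x))
      (𝓝 (M * (gauge K x / ρ) ^ k)) := by
    have : Continuous fun R' : ℝ => M * (R' / ρ) ^ k := by fun_prop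
    exact (this.tendsto _).mono_left nhdsWithin_le_nhds
  exact ge_of_tendsto l (eventually_mem_nhdsWithin.mono fun R' h => key R' h)

/-- The slice t ↦ φ(tx) is holomorphic on |t| < ρ, and its Taylor series is evaluated at t = 1. In
the tail, each power of the gauge is bounded by the n-th one and the powers of ρ⁻¹ are summed, so
the constant is free of x and n. -/
lemma norm_sub_taylor_le (hK : IsAbsConvexCompactNhd K) {ρ : ℝ} (hρ : 1 < ρ) {φ : Cn d → ℂ}
    (hφ : ∀ y ∈ K, AnalyticAt ℂ φ ((ρ : ℂ) • y)) {M : ℝ} (hM : ∀ y ∈ K, ‖φ ((ρ : ℂ) • y)‖ ≤ M)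
    {x : Cn d} (hx : x ∈ K) (n : ℕ) :
    ‖φ x - ∑ k ∈ Finset.range (n + 1), homPart φ k x‖ ≤ M * (1 - ρ⁻¹)⁻¹ * gauge K x ^ n := by
  have hρ0 : 0 < ρ := one_pos.trans hρ
  have hM0 : 0 ≤ M := (norm_nonneg _).trans (hM 0 hK.zero_mem)
  have hd : DifferentiableOn ℂ (fun t : ℂ => φ (t • x)) (Metric.ball 0 ρ) := by
    intro t ht
    rw [mem_ball_zero_iff] at ht
    obtain ⟨y, hy, he⟩ := hK.slice_bound (t := t) hρ0 one_pos ⟨x, hx, one_smul _ _⟩ (by simpa using ht.le)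
    exact (analyticAt_slice (by rw [he]; exact hφ y hy)).differentiableAt.differentiableWithinAt
  have hs : HasSum (fun k => homPart φ k x) (φ x) := by
    have := Complex.hasSum_taylorSeries_on_ball hd (z := 1) (by simpa using hρ)
    simpa [homPart] using this
  have hs' := (hasSum_nat_add_iff' (n + 1)).2 hs
  have hg0 := gauge_nonneg (s := K) x
  have hg1 := hK.gauge_le_one hx
  have hgeo : HasSum (fun k : ℕ => M * gauge K x ^ n * (ρ⁻¹) ^ k) (M * gauge K x ^ n * (1 - ρ⁻¹)⁻¹) :=
    (hasSum_geometric_of_lt_one (by positivity) (inv_lt_one_of_one_lt₀ hρ)).mul_left _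
  have hb : ∀ k, ‖homPart φ (k + (n + 1)) x‖ ≤ M * gauge K x ^ n * (ρ⁻¹) ^ k := fun k => by
    refine (hK.norm_homPart_le hρ0 hφ hM _ x).trans ?_
    rw [div_eq_mul_inv, mul_pow, mul_assoc]
    have h1 : gauge K x ^ (k + (n + 1)) ≤ gauge K x ^ n := pow_le_pow_of_le_one hg0 hg1 (by omega)
    have h2 : (ρ⁻¹) ^ (k + (n + 1)) ≤ (ρ⁻¹) ^ k :=
      pow_le_pow_of_le_one (by positivity) (inv_le_one_of_one_le₀ hρ.le) (by omega)
    gcongr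
  have := tsum_of_norm_bounded hgeo hb
  rw [hs'.tsum_eq] at this
  linarith [this]

end IsAbsConvexCompactNhd

/-! ### The truncated Fock kernel -/

/-- The multinomial theorem, degree by degree. -/
lemma sum_prod_pow_div_factorial {𝕜 : Type*} [Field 𝕜] [CharZero 𝕜] {d : ℕ} (a : Fin d → 𝕜)
    (n : ℕ) :
    ∑ α : MultiIndex d n, (∏ i, a i ^ α.1 i) / ((∏ i, (α.1 i).factorial : ℕ) : 𝕜) =
      ∑ k ∈ Finset.range (n + 1), (∑ i, a i) ^ k / (k.factorial : 𝕜) := by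
  rw [sum_multiIndex (fun α => (∏ i, a i ^ α i) / ((∏ i, (α i).factorial : ℕ) : 𝕜))]
  refine Finset.sum_congr rfl fun k _ => ?_
  rw [Finset.sum_pow_eq_sum_piAntidiag, Finset.sum_div]
  refine Finset.sum_congr rfl fun α hα => ?_
  have h := Nat.multinomial_spec Finset.univ α
  rw [(Finset.mem_piAntidiag.1 hα).1] at h
  have h1 : ((∏ i, (α i).factorial : ℕ) : 𝕜) ≠ 0 := by
    exact_mod_cast Finset.prod_ne_zero_iff.2 fun i _ => (α i).factorial_ne_zero
  have h2 : (k.factorial : 𝕜) ≠ 0 := by exact_mod_cast k.factorial_ne_zero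
  rw [div_eq_div_iff h1 h2, ← h]
  push_cast
  ring

lemma norm_sum_mul_le {ι : Type*} (s : Finset ι) (a b : ι → ℂ) :
    ‖∑ i ∈ s, a i * b i‖ ≤ √(∑ i ∈ s, ‖a i‖ ^ 2) * √(∑ i ∈ s, ‖b i‖ ^ 2) := by
  refine (norm_sum_le _ _).trans ?_
  simp only [norm_mul]
  exact Real.sum_mul_le_sqrt_mul_sqrt s _ _

lemma inner_eq_sum {d : ℕ} (x y : Cn d) : inner ℂ x y = ∑ i, conj (x i) * y i := by
  simp [PiLp.inner_apply, mul_comm]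

lemma fockFun_mul_conj {d : ℕ} (q : Cn d) (β : Fin d → ℕ) (w' w : Cn d) :
    fockFun q β w' * conj (fockFun q β w) =
      (Real.exp (-‖q‖ ^ 2) : ℂ) * Complex.exp (inner ℂ q w') * conj (Complex.exp (inner ℂ q w)) *
        ((∏ i, (conj ((w - q) i) * (w' - q) i) ^ β i) / ((∏ i, (β i).factorial : ℕ) : ℂ)) := by
  have h0 : (0 : ℝ) < ((∏ i, (β i).factorial : ℕ) : ℝ) := by
    exact_mod_cast Finset.prod_pos fun i _ => (β i).factorial_pos
  have h1 : ((Real.exp (-‖q‖ ^ 2 / 2) / √((∏ i, (β i).factorial : ℕ) : ℝ) : ℝ) : ℂ) *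
      ((Real.exp (-‖q‖ ^ 2 / 2) / √((∏ i, (β i).factorial : ℕ) : ℝ) : ℝ) : ℂ) =
      (Real.exp (-‖q‖ ^ 2) : ℂ) / ((∏ i, (β i).factorial : ℕ) : ℂ) := by
    rw [← Complex.ofReal_mul, div_mul_div_comm, Real.mul_self_sqrt h0.le, ← Real.exp_add,
      Complex.ofReal_div]
    congr 3
    · ring_nf
  simp only [fockFun, map_mul, Complex.conj_ofReal, monomial, mul_pow, Finset.prod_mul_distrib,
    map_prod, map_pow]
  linear_combination (∏ i, (w' - q) i ^ β i) * Complex.exp (inner ℂ q w') *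
    (∏ i, conj ((w - q) i) ^ β i) * conj (Complex.exp (inner ℂ q w)) * h1

lemma sum_fockFun_mul_conj {d : ℕ} (q : Cn d) (m : ℕ) (w' w : Cn d) :
    ∑ β : MultiIndex d m, fockFun q β.1 w' * conj (fockFun q β.1 w) =
      (Real.exp (-‖q‖ ^ 2) : ℂ) * Complex.exp (inner ℂ q w') * conj (Complex.exp (inner ℂ q w)) *
        ∑ k ∈ Finset.range (m + 1), (inner ℂ (w - q) (w' - q)) ^ k / (k.factorial : ℂ) := by
  simp only [fockFun_mul_conj, ← Finset.mul_sum]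
  rw [sum_prod_pow_div_factorial (fun i => conj ((w - q) i) * (w' - q) i), inner_eq_sum (w - q) (w' - q)]

/-- On the diagonal the truncated exponential is at most e^{‖w-q‖²}, and the exponents -‖q‖² + 2 Re
q^*w + ‖w-q‖² add up to ‖w‖². -/
lemma sum_norm_fockFun_sq_le {d : ℕ} (q : Cn d) (m : ℕ) (w : Cn d) :
    ∑ β : MultiIndex d m, ‖fockFun q β.1 w‖ ^ 2 ≤ Real.exp (‖w‖ ^ 2) := by
  have h := sum_fockFun_mul_conj q m w w
  simp only [Complex.mul_conj', inner_self_eq_norm_sq_to_K] at h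
  have h' : ((∑ β : MultiIndex d m, ‖fockFun q β.1 w‖ ^ 2 : ℝ) : ℂ) =
      ((Real.exp (-‖q‖ ^ 2) * ‖Complex.exp (inner ℂ q w)‖ ^ 2 *
        ∑ k ∈ Finset.range (m + 1), (‖w - q‖ ^ 2) ^ k / (k.factorial : ℝ) : ℝ) : ℂ) := by
    push_cast
    rw [h, mul_assoc (Complex.ofReal _), Complex.mul_conj']
    push_cast
    rfl
  have h'' := Complex.ofReal_injective h'
  rw [h'', Complex.norm_exp, ← Real.exp_nat_mul, ← Real.exp_add]
  refine (mul_le_mul_of_nonneg_left (Real.sum_le_exp_of_nonneg (by positivity) _)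
    (Real.exp_pos _).le).trans ?_
  rw [← Real.exp_add, Real.exp_le_exp, @norm_sub_sq ℂ, inner_re_symm]
  simp only [RCLike.re_to_complex]
  push_cast
  linarith

/-! ### Recovering coordinates from the derivatives of the Fock basis at the origin -/

/-- The partial derivative `∂ᵢ v_{q,β}(0)`. -/
def fockDeriv {d : ℕ} (q : Cn d) (i : Fin d) (β : Fin d → ℕ) : ℂ :=
  lineDeriv ℂ (fockFun q β) 0 (EuclideanSpace.single i (1 : ℂ))

lemma differentiable_monomial {d : ℕ} (β : Fin d → ℕ) :
    Differentiable ℂ fun z : Cn d => monomial z β := by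
  unfold monomial
  fun_prop

lemma differentiable_fockFun {d : ℕ} (q : Cn d) (β : Fin d → ℕ) :
    Differentiable ℂ (fockFun q β) := by
  have h1 : Differentiable ℂ fun z : Cn d => monomial (z - q) β :=
    (differentiable_monomial β).comp (differentiable_id.sub_const q)
  have h2 : Differentiable ℂ fun z : Cn d => (inner ℂ q z : ℂ) :=
    (innerSL ℂ q).differentiable
  unfold fockFun
  fun_prop

lemma hasDerivAt_fockFun_line {d : ℕ} (q : Cn d) (i : Fin d) (β : Fin d → ℕ) :
    HasDerivAt (fun t : ℂ => fockFun q β (t • EuclideanSpace.single i (1 : ℂ)))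
      (fockDeriv q i β) 0 := by
  have := ((differentiable_fockFun q β) 0).lineDifferentiableAt
    (v := EuclideanSpace.single i (1 : ℂ)) |>.hasLineDerivAt
  simpa [HasLineDerivAt, fockDeriv] using this

lemma hasDerivAt_sum_range_pow (m : ℕ) (s : ℂ) :
    HasDerivAt (fun s : ℂ => ∑ k ∈ Finset.range (m + 1), s ^ k / (k.factorial : ℂ))
      (∑ k ∈ Finset.range m, s ^ k / (k.factorial : ℂ)) s := by
  have h : HasDerivAt (fun s : ℂ => ∑ k ∈ Finset.range (m + 1), s ^ k / (k.factorial : ℂ))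
      (∑ k ∈ Finset.range (m + 1), (k * s ^ (k - 1)) / (k.factorial : ℂ)) s :=
    HasDerivAt.fun_sum fun k _ => (hasDerivAt_pow k s).div_const _
  convert! h using 1
  rw [Finset.sum_range_succ']
  simp only [Nat.cast_zero, zero_mul, zero_div, add_zero, Nat.add_sub_cancel]
  refine Finset.sum_congr rfl fun k _ => ?_
  have h1 : (k.factorial : ℂ) ≠ 0 := by exact_mod_cast k.factorial_ne_zero
  have h2 : ((k : ℂ) + 1) ≠ 0 := by exact_mod_cast k.succ_ne_zero
  rw [Nat.factorial_succ]
  push_cast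
  field_simp

/-- The identity for the truncated kernel, differentiated in w' at 0 along the i-th axis. The
derivative of a truncated exponential is one term shorter, whence the two ranges. -/
lemma sum_fockDeriv_mul_conj {d : ℕ} (q : Cn d) (m : ℕ) (i : Fin d) (w : Cn d) :
    ∑ β : MultiIndex d m, fockDeriv q i β.1 * conj (fockFun q β.1 w) =
      Complex.exp (inner ℂ (w - q) q) *
        (conj (q i) * ∑ k ∈ Finset.range (m + 1), (-inner ℂ (w - q) q) ^ k / (k.factorial : ℂ) +
          conj ((w - q) i) *
            ∑ k ∈ Finset.range m, (-inner ℂ (w - q) q) ^ k / (k.factorial : ℂ)) := by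
  let e : Cn d := EuclideanSpace.single i (1 : ℂ)
  have h1 : HasDerivAt (fun t : ℂ => ∑ β : MultiIndex d m,
      fockFun q β.1 (t • e) * conj (fockFun q β.1 w))
      (∑ β : MultiIndex d m, fockDeriv q i β.1 * conj (fockFun q β.1 w)) 0 :=
    HasDerivAt.fun_sum fun β _ => (hasDerivAt_fockFun_line q i β.1).mul_const _
  simp only [sum_fockFun_mul_conj] at h1
  have e1 : ∀ x : Cn d, inner ℂ x e = conj (x i) := fun x => by
    simp [e, EuclideanSpace.inner_single_right]
  have hq : HasDerivAt (fun t : ℂ => (inner ℂ q (t • e) : ℂ)) (conj (q i)) 0 := by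
    simp only [inner_smul_right, e1]
    simpa using (hasDerivAt_id (0 : ℂ)).mul_const (conj (q i))
  have hw : HasDerivAt (fun t : ℂ => (inner ℂ (w - q) (t • e - q) : ℂ)) (conj ((w - q) i)) 0 := by
    simp only [inner_sub_right, inner_smul_right, e1]
    simpa using ((hasDerivAt_id (0 : ℂ)).mul_const (conj ((w - q) i))).sub_const
      (inner ℂ (w - q) q)
  have hw0 : (inner ℂ (w - q) ((0 : ℂ) • e - q) : ℂ) = -inner ℂ (w - q) q := by
    rw [zero_smul, zero_sub, inner_neg_right]
  have hE := (hasDerivAt_sum_range_pow m (inner ℂ (w - q) ((0 : ℂ) • e - q))).comp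
    (0 : ℂ) hw
  rw [hw0] at hE
  have h2 := ((hq.cexp.const_mul (Real.exp (-‖q‖ ^ 2) : ℂ)).mul_const
    (conj (Complex.exp (inner ℂ q w)))).mul hE
  have h3 := h1.unique h2
  have hexp : (Real.exp (-‖q‖ ^ 2) : ℂ) * conj (Complex.exp (inner ℂ q w)) =
      Complex.exp (inner ℂ (w - q) q) := by
    have hi : (inner ℂ (w - q) q : ℂ) = ((-‖q‖ ^ 2 : ℝ) : ℂ) + inner ℂ w q := by
      rw [inner_sub_left, inner_self_eq_norm_sq_to_K]
      push_cast
      simp only [Complex.coe_algebraMap]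
      ring
    rw [← Complex.exp_conj, inner_conj_symm, Complex.ofReal_exp, ← Complex.exp_add, hi]
  rw [h3, ← hexp]
  simp
  ring

/-- The function `∑_{|β| ≤ m} conj(∂ᵢ v_{q,β}(0)) v_{q,β}`. -/
def coordApprox {d : ℕ} (q : Cn d) (m : ℕ) (i : Fin d) (w : Cn d) : ℂ :=
  ∑ β : MultiIndex d m, fockFun q β.1 w * conj (fockDeriv q i β.1)

lemma conj_coordApprox {d : ℕ} (q : Cn d) (m : ℕ) (i : Fin d) (w : Cn d) :
    conj (coordApprox q m i w) = ∑ β : MultiIndex d m, fockDeriv q i β.1 * conj (fockFun q β.1 w) := by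
  simp [coordApprox, mul_comm]

lemma differentiable_coordApprox {d : ℕ} (q : Cn d) (m : ℕ) (i : Fin d) :
    Differentiable ℂ (coordApprox q m i) := by
  have := fun β : MultiIndex d m => differentiable_fockFun q β.1
  unfold coordApprox
  fun_prop

lemma norm_exp_neg_mul_sum_sub_one_le (s : ℂ) (n : ℕ) :
    ‖Complex.exp (-s) * ∑ k ∈ Finset.range n, s ^ k / (k.factorial : ℂ) - 1‖ ≤
      Real.exp (2 * ‖s‖) * ‖s‖ ^ n := by
  have h : Complex.exp (-s) * ∑ k ∈ Finset.range n, s ^ k / (k.factorial : ℂ) - 1 =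
      -(Complex.exp (-s) * (Complex.exp s - ∑ k ∈ Finset.range n, s ^ k / (k.factorial : ℂ))) := by
    rw [mul_sub, ← Complex.exp_add]
    simp
  rw [h, norm_neg, norm_mul]
  have h1 := Complex.norm_exp_sub_sum_le_norm_mul_exp s n
  have h2 := Complex.norm_exp_le_exp_norm (-s)
  rw [norm_neg] at h2
  calc _ ≤ Real.exp ‖s‖ * (‖s‖ ^ n * Real.exp ‖s‖) := by gcongr
    _ = _ := by rw [two_mul, Real.exp_add]; ring

/-- With full exponential series, `sum_fockDeriv_mul_conj` would return conj(w_i) exactly. The error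
thus consists of two exponential tails in s = -⟨w-q, q⟩, which is O(‖w-q‖); the shorter sum loses
one order, and its factor conj((w-q)_i) restores it. -/
lemma coordApprox_sub_isBigO {d : ℕ} (q : Cn d) (m : ℕ) (i : Fin d) :
    (fun w => coordApprox q m i w - w i) =O[𝓝 q] fun w => ‖w - q‖ ^ (m + 1) := by
  refine Asymptotics.IsBigO.of_bound (‖q‖ * (Real.exp (2 * ‖q‖) * ‖q‖ ^ (m + 1)) +
    Real.exp (2 * ‖q‖) * ‖q‖ ^ m) ?_
  filter_upwards [Metric.ball_mem_nhds q one_pos] with w hw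
  set y := w - q with hy
  have hy1 : ‖y‖ ≤ 1 := by
    rw [mem_ball_iff_norm] at hw
    exact hw.le
  set s : ℂ := -inner ℂ y q with hs
  have hs1 : ‖s‖ ≤ ‖y‖ * ‖q‖ := by rw [hs, norm_neg]; exact norm_inner_le_norm y q
  have hs2 : ‖s‖ ≤ ‖q‖ := hs1.trans (mul_le_of_le_one_left (norm_nonneg _) hy1)
  have key : conj (coordApprox q m i w - w i) =
      conj (q i) * (Complex.exp (-s) * ∑ k ∈ Finset.range (m + 1), s ^ k / (k.factorial : ℂ) - 1) +
      conj (y i) * (Complex.exp (-s) * ∑ k ∈ Finset.range m, s ^ k / (k.factorial : ℂ) - 1) := by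
    rw [map_sub, conj_coordApprox, sum_fockDeriv_mul_conj, ← hy, ← hs,
      show (inner ℂ y q : ℂ) = -s by simp [hs], show w i = q i + y i by simp [hy], map_add]
    ring
  have e1 : ‖conj (q i)‖ ≤ ‖q‖ := by
    rw [RCLike.norm_conj]; exact PiLp.norm_apply_le q i
  have e2 : ‖conj (y i)‖ ≤ ‖y‖ := by
    rw [RCLike.norm_conj]; exact PiLp.norm_apply_le y i
  have b : ∀ n, ‖Complex.exp (-s) * ∑ k ∈ Finset.range n, s ^ k / (k.factorial : ℂ) - 1‖ ≤
      Real.exp (2 * ‖q‖) * (‖y‖ * ‖q‖) ^ n := fun n =>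
    (norm_exp_neg_mul_sum_sub_one_le s n).trans (by gcongr)
  rw [← RCLike.norm_conj, key, norm_pow, norm_norm]
  calc _ ≤ ‖q‖ * (Real.exp (2 * ‖q‖) * (‖y‖ * ‖q‖) ^ (m + 1)) +
        ‖y‖ * (Real.exp (2 * ‖q‖) * (‖y‖ * ‖q‖) ^ m) := by
        refine (norm_add_le _ _).trans ?_
        rw [norm_mul, norm_mul]
        have b1 := b (m + 1)
        have b2 := b m
        gcongr
    _ = _ := by ring

/-- A self-bounding argument: the sum S is itself the derivative at 0 of `coordApprox q m i` along
the i-th axis, and Cauchy's estimate on the unit circle bounds it by √e·√S. Hence S ≤ e for every m.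
-/
lemma sum_norm_fockDeriv_sq_le {d : ℕ} (q : Cn d) (m : ℕ) (i : Fin d) :
    ∑ β : MultiIndex d m, ‖fockDeriv q i β.1‖ ^ 2 ≤ Real.exp 1 := by
  set S := ∑ β : MultiIndex d m, ‖fockDeriv q i β.1‖ ^ 2 with hS
  have hS0 : 0 ≤ S := Finset.sum_nonneg fun _ _ => by positivity
  let Φ : ℂ → ℂ := fun t => coordApprox q m i (t • EuclideanSpace.single i (1 : ℂ))
  have hd : HasDerivAt Φ (S : ℂ) 0 := by
    have : HasDerivAt Φ (∑ β : MultiIndex d m, fockDeriv q i β.1 * conj (fockDeriv q i β.1)) 0 :=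
      HasDerivAt.fun_sum fun β _ => (hasDerivAt_fockFun_line q i β.1).mul_const _
    convert this using 1
    rw [hS]
    push_cast
    exact Finset.sum_congr rfl fun β _ => (Complex.mul_conj' _).symm
  have hΦ : Differentiable ℂ Φ := by
    have := differentiable_coordApprox q m i
    fun_prop
  have h1 := Complex.norm_deriv_le_of_forall_mem_sphere_norm_le (C := √(Real.exp 1) * √S) one_pos
    (hΦ.diffContOnCl (s := Metric.ball 0 1)) fun t ht => by
      rw [mem_sphere_zero_iff_norm] at ht
      refine (norm_sum_mul_le _ _ _).trans ?_
      simp only [RCLike.norm_conj, ← hS]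
      gcongr
      refine (sum_norm_fockFun_sq_le q m _).trans_eq ?_
      simp [norm_smul, ht]
  rw [hd.deriv, Complex.norm_real, Real.norm_of_nonneg hS0, div_one] at h1
  rcases hS0.eq_or_lt with h0 | h0
  · rw [← h0]; positivity
  · have h2 : √S * √S ≤ √(Real.exp 1) * √S := by rwa [Real.mul_self_sqrt hS0]
    exact (Real.sqrt_le_sqrt_iff (by positivity)).1 (le_of_mul_le_mul_right h2 (Real.sqrt_pos.2 h0))

lemma norm_coordApprox_le {d : ℕ} (q : Cn d) (m : ℕ) (i : Fin d) (w : Cn d) :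
    ‖coordApprox q m i w‖ ≤ √(Real.exp (‖w‖ ^ 2)) * √(Real.exp 1) := by
  refine (norm_sum_mul_le _ _ _).trans ?_
  simp only [RCLike.norm_conj]
  have h1 := sum_norm_fockFun_sq_le q m w
  have h2 := sum_norm_fockDeriv_sq_le q m i
  gcongr

/-! ### Least squares by the pseudo-inverse -/

lemma star_dotProduct_self {ι : Type*} [Fintype ι] (v : ι → ℂ) :
    star v ⬝ᵥ v = ((∑ k, ‖v k‖ ^ 2 : ℝ) : ℂ) := by
  push_cast
  exact Finset.sum_congr rfl fun k _ => Complex.conj_mul' (v k)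

lemma sum_norm_sq_mulVec_le_of_proj {κ : Type*} [Fintype κ] {P : Matrix κ κ ℂ} (hP : Pᴴ = P)
    (hPP : P * P = P) (y : κ → ℂ) : ∑ k, ‖(P *ᵥ y) k‖ ^ 2 ≤ ∑ k, ‖y k‖ ^ 2 := by
  have hPy : P *ᵥ (y - P *ᵥ y) = 0 := by
    rw [Matrix.mulVec_sub, Matrix.mulVec_mulVec, hPP, sub_self]
  have h1 : star (P *ᵥ y) ⬝ᵥ (y - P *ᵥ y) = 0 := by
    rw [Matrix.star_mulVec, ← Matrix.dotProduct_mulVec, hP, hPy, dotProduct_zero]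
  have h2 : star (y - P *ᵥ y) ⬝ᵥ (P *ᵥ y) = 0 := by
    rw [Matrix.dotProduct_mulVec]
    have := congrArg star hPy
    rw [Matrix.star_mulVec, hP, star_zero] at this
    rw [this, zero_dotProduct]
  have h3 : star y ⬝ᵥ y = star (P *ᵥ y) ⬝ᵥ (P *ᵥ y) + star (y - P *ᵥ y) ⬝ᵥ (y - P *ᵥ y) := by
    have e : y = P *ᵥ y + (y - P *ᵥ y) := by abel
    conv_lhs => rw [e, star_add, add_dotProduct, dotProduct_add, dotProduct_add, h1, h2]
    simp
  simp only [star_dotProduct_self] at h3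
  have h4 : (∑ k, ‖y k‖ ^ 2 : ℝ) = ∑ k, ‖(P *ᵥ y) k‖ ^ 2 + ∑ k, ‖(y - P *ᵥ y) k‖ ^ 2 := by
    exact_mod_cast h3
  rw [h4]
  exact le_add_of_nonneg_right (Finset.sum_nonneg fun _ _ => by positivity)

lemma mul_pinv_conjTranspose_mul {κ ι : Type*} [Fintype κ] [Fintype ι] [DecidableEq κ]
    (U : Matrix κ ι ℂ) : U * (pinv Uᴴ)ᴴ * U = U := by
  have h := congrArg Matrix.conjTranspose (pinv_spec Uᴴ).1
  simpa [Matrix.conjTranspose_mul, Matrix.mul_assoc] using h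

lemma isHermitian_mul_pinv_conjTranspose {κ ι : Type*} [Fintype κ] [Fintype ι] [DecidableEq κ]
    (U : Matrix κ ι ℂ) : (U * (pinv Uᴴ)ᴴ)ᴴ = U * (pinv Uᴴ)ᴴ := by
  have h := (pinv_spec Uᴴ).2.2.2
  rw [Matrix.conjTranspose_mul, Matrix.conjTranspose_conjTranspose] at h
  rw [Matrix.conjTranspose_mul, Matrix.conjTranspose_conjTranspose, h]

/-- The matrix `(pinv Uᴴ)ᴴ` is a pseudo-inverse of U, so U times it is an orthogonal projection and
therefore a contraction. -/
lemma sum_norm_sq_leastSquares_le {κ ι : Type*} [Fintype κ] [Fintype ι] [DecidableEq κ]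
    (U : Matrix κ ι ℂ) (y : κ → ℂ) :
    ∑ k, ‖(U *ᵥ ((pinv Uᴴ)ᴴ *ᵥ y)) k‖ ^ 2 ≤ ∑ k, ‖y k‖ ^ 2 := by
  rw [Matrix.mulVec_mulVec]
  refine sum_norm_sq_mulVec_le_of_proj (isHermitian_mul_pinv_conjTranspose U) ?_ y
  rw [← Matrix.mul_assoc, mul_pinv_conjTranspose_mul]

lemma leastSquares_mulVec {κ ι : Type*} [Fintype κ] [Fintype ι] [DecidableEq κ]
    {U : Matrix κ ι ℂ} (hU : ∀ v, U *ᵥ v = 0 → v = 0) (v : ι → ℂ) :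
    (pinv Uᴴ)ᴴ *ᵥ (U *ᵥ v) = v := by
  refine sub_eq_zero.1 (hU _ ?_)
  rw [Matrix.mulVec_sub, Matrix.mulVec_mulVec, Matrix.mulVec_mulVec, mul_pinv_conjTranspose_mul,
    sub_self]

/-- Contracting the rows of the target matrix with the conjugate derivatives gives values of
`coordApprox`, so each component is a truncated scalar least-squares fit. -/
lemma reconstruction_apply {d r N m n : ℕ} (h : m ≤ n) (p : Cn d) (f : Cn d → Cn r)
    (Z : Fin N → Cn d) (z : Cn d) (i : Fin r) :
    reconstruction h p f Z z i = ∑ α : MultiIndex d m, fockFun p α.1 z *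
      ((pinv (fockMatrix p n Z)ᴴ)ᴴ *ᵥ fun k => coordApprox (f p) m i (f (Z k)))
        (MultiIndex.incl h α) := by
  have h1 : (fun k => coordApprox (f p) m i (f (Z k))) =
      fockMatrix (f p) m (fun k => f (Z k)) *ᵥ star (fun β : MultiIndex r m =>
        lineDeriv ℂ (fockFun (f p) β.1) 0 (EuclideanSpace.single i (1 : ℂ))) := by
    ext k
    rfl
  rw [h1, Matrix.mulVec_mulVec]
  have h2 : (empMatrix h p f Z)ᴴ = ((pinv (fockMatrix p n Z)ᴴ)ᴴ *
      fockMatrix (f p) m (fun k => f (Z k))).submatrix (MultiIndex.incl h) id := by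
    rw [empMatrix, Matrix.conjTranspose_submatrix, Matrix.conjTranspose_mul,
      Matrix.conjTranspose_conjTranspose]
  simp only [reconstruction, h2]
  rfl

/-! ### Sampling stability -/

/-- The lower frame bound `c` for the sample `z` on polynomials of degree `≤ n`. -/
def IsStableSample {d N : ℕ} (n : ℕ) (z : Fin N → Cn d) (c : ℝ) : Prop :=
  ∀ v : MultiIndex d n → ℂ,
    c * ∑ α, ‖v α‖ ^ 2 ≤ (N : ℝ)⁻¹ * ∑ k, ‖∑ α, v α * monomial (z k) α.1‖ ^ 2

/-- The weight `e^{-‖p‖²/2} e^{p^*(p+x)}`. -/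
def fockWeight {d : ℕ} (p x : Cn d) : ℂ :=
  (Real.exp (-‖p‖ ^ 2 / 2) : ℂ) * Complex.exp (inner ℂ p (p + x))

lemma fockWeight_ne_zero {d : ℕ} (p x : Cn d) : fockWeight p x ≠ 0 :=
  mul_ne_zero (by exact_mod_cast (Real.exp_pos _).ne') (Complex.exp_ne_zero _)

lemma differentiable_fockWeight {d : ℕ} (p : Cn d) : Differentiable ℂ (fockWeight p) := by
  have h2 : Differentiable ℂ fun z : Cn d => (inner ℂ p (p + z) : ℂ) :=
    (innerSL ℂ p).differentiable.comp (differentiable_id.const_add p)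
  unfold fockWeight
  fun_prop

lemma analyticAt_inner_left {d : ℕ} (q z : Cn d) :
    AnalyticAt ℂ (fun z : Cn d => (inner ℂ q z : ℂ)) z :=
  (innerSL ℂ q).analyticAt z

lemma analyticAt_fockWeight {d : ℕ} (p x : Cn d) : AnalyticAt ℂ (fockWeight p) x := by
  have h := AnalyticAt.fun_comp (g := fun z : Cn d => (inner ℂ p z : ℂ)) (f := fun x => p + x)
    (analyticAt_inner_left p (p + x)) (by fun_prop)
  exact analyticAt_const.mul h.cexp'

lemma analyticAt_fockFun {d : ℕ} (q : Cn d) (β : Fin d → ℕ) (w : Cn d) :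
    AnalyticAt ℂ (fockFun q β) w := by
  have h : AnalyticAt ℂ (fun z : Cn d => monomial (z - q) β) w := by
    refine Finset.analyticAt_fun_prod _ fun i _ => AnalyticAt.fun_pow ?_ _
    exact AnalyticAt.fun_comp (g := fun z : Cn d => z i)
      ((EuclideanSpace.proj i : Cn d →L[ℂ] ℂ).analyticAt _) (by fun_prop)
  exact (analyticAt_const.mul h).mul (analyticAt_inner_left q w).cexp'

lemma analyticAt_coordApprox {d : ℕ} (q : Cn d) (m : ℕ) (i : Fin d) (w : Cn d) :
    AnalyticAt ℂ (coordApprox q m i) w :=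
  Finset.analyticAt_fun_sum _ fun β _ => (analyticAt_fockFun q β.1 w).mul analyticAt_const

/-- `√(α!)`. -/
def sqrtFactorial {d : ℕ} (α : Fin d → ℕ) : ℝ := √((∏ i, (α i).factorial : ℕ) : ℝ)

lemma prod_factorial_pos {d : ℕ} (α : Fin d → ℕ) : (0 : ℝ) < ((∏ i, (α i).factorial : ℕ) : ℝ) := by
  exact_mod_cast Finset.prod_pos fun i _ => (α i).factorial_pos

lemma sqrtFactorial_pos {d : ℕ} (α : Fin d → ℕ) : 0 < sqrtFactorial α :=
  Real.sqrt_pos.2 (prod_factorial_pos α)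

lemma sqrtFactorial_sq_le {d m : ℕ} {α : Fin d → ℕ} (hα : ∑ i, α i ≤ m) :
    sqrtFactorial α ^ 2 ≤ (m.factorial : ℝ) := by
  rw [sqrtFactorial, Real.sq_sqrt (prod_factorial_pos α).le]
  exact_mod_cast (Nat.le_of_dvd (Nat.factorial_pos _)
    (Nat.prod_factorial_dvd_factorial_sum _ _)).trans (Nat.factorial_le hα)

lemma fockFun_add {d : ℕ} (p x : Cn d) (α : Fin d → ℕ) :
    fockFun p α (p + x) = fockWeight p x * monomial x α / (sqrtFactorial α : ℂ) := by
  simp only [fockFun, fockWeight, sqrtFactorial, add_sub_cancel_left, Complex.ofReal_div]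
  ring

lemma MultiIndex.incl_injective {d m n : ℕ} (h : m ≤ n) :
    Function.Injective (MultiIndex.incl (d := d) h) := fun α β hab => by
  have := congrArg Subtype.val hab
  exact Subtype.ext this

/-- After division of the coefficients by √(α!), a Fock combination is the weight times a
polynomial, to which the frame bound applies; the lower bound of the weight enters squared. -/
lemma IsStableSample.sum_div_le {d N n : ℕ} {z : Fin N → Cn d} {c : ℝ} (hc : 0 < c)
    (h : IsStableSample n z c) {p : Cn d} {w : ℝ} (hw : 0 < w)
    (hwz : ∀ k, w ≤ ‖fockWeight p (z k)‖) (v : MultiIndex d n → ℂ) :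
    ∑ α, (‖v α‖ / sqrtFactorial α.1) ^ 2 ≤
      (c * w ^ 2)⁻¹ * ((N : ℝ)⁻¹ * ∑ k, ‖(fockMatrix p n (fun k => p + z k) *ᵥ v) k‖ ^ 2) := by
  have h1 := h fun α => v α / (sqrtFactorial α.1 : ℂ)
  have h2 : ∀ k, w ^ 2 * ‖∑ α, v α / (sqrtFactorial α.1 : ℂ) * monomial (z k) α.1‖ ^ 2 ≤
      ‖(fockMatrix p n (fun k => p + z k) *ᵥ v) k‖ ^ 2 := fun k => by
    have e : (fockMatrix p n (fun k => p + z k) *ᵥ v) k =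
        fockWeight p (z k) * ∑ α, v α / (sqrtFactorial α.1 : ℂ) * monomial (z k) α.1 := by
      rw [Finset.mul_sum]
      refine Finset.sum_congr rfl fun α _ => ?_
      simp only [fockMatrix, fockVec, Matrix.of_apply, fockFun_add]
      ring
    rw [e, norm_mul, mul_pow]
    have := hwz k
    gcongr
  have h3 : ∀ α : MultiIndex d n, ‖v α / (sqrtFactorial α.1 : ℂ)‖ = ‖v α‖ / sqrtFactorial α.1 :=
    fun α => by
      rw [norm_div, Complex.norm_real, Real.norm_of_nonneg (sqrtFactorial_pos _).le]
  simp only [h3] at h1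
  have h4 := Finset.sum_le_sum fun k (_ : k ∈ Finset.univ) => h2 k
  rw [← Finset.mul_sum] at h4
  rw [mul_inv, mul_assoc, ← div_eq_inv_mul, le_div_iff₀' hc]
  refine h1.trans ?_
  rw [← mul_assoc, mul_comm (w ^ 2)⁻¹, mul_assoc]
  gcongr
  rwa [← div_eq_inv_mul, le_div_iff₀' (by positivity)]

lemma IsStableSample.injective {d N n : ℕ} {z : Fin N → Cn d} {c : ℝ} (hc : 0 < c)
    (h : IsStableSample n z c) (p : Cn d) (v : MultiIndex d n → ℂ)
    (hv : fockMatrix p n (fun k => p + z k) *ᵥ v = 0) : v = 0 := by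
  obtain ⟨w, hw, hwz⟩ : ∃ w > 0, ∀ k, w ≤ ‖fockWeight p (z k)‖ := by
    rcases isEmpty_or_nonempty (Fin N) with hN | hN
    · exact ⟨1, one_pos, fun k => hN.elim k⟩
    · obtain ⟨k, hk⟩ := Finite.exists_min fun k => ‖fockWeight p (z k)‖
      exact ⟨_, norm_pos_iff.2 (fockWeight_ne_zero p (z k)), hk⟩
  have h1 := h.sum_div_le hc hw hwz v
  rw [hv] at h1
  simp only [Pi.zero_apply, norm_zero, ne_eq, OfNat.ofNat_ne_zero, not_false_eq_true, zero_pow,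
    Finset.sum_const_zero, mul_zero] at h1
  have h2 := (Finset.sum_eq_zero_iff_of_nonneg fun α _ => by positivity).1
    (h1.antisymm (Finset.sum_nonneg fun α _ => by positivity))
  ext α
  have h3 := h2 α (Finset.mem_univ _)
  simpa [(sqrtFactorial_pos α.1).ne'] using h3

/-- Contractivity of the fit controls the coefficients divided by √(α!). Undoing this normalisation
costs m! and not n!, because only degrees ≤ m are evaluated. -/
lemma IsStableSample.norm_truncated_le {d N m n : ℕ} (hmn : m ≤ n) {z : Fin N → Cn d} {c : ℝ}
    (hc : 0 < c) (h : IsStableSample n z c) {p : Cn d} {w : ℝ} (hw : 0 < w)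
    (hwz : ∀ k, w ≤ ‖fockWeight p (z k)‖) (y : Fin N → ℂ) (x : Cn d) :
    ‖∑ α : MultiIndex d m, fockFun p α.1 x *
      ((pinv (fockMatrix p n fun k => p + z k)ᴴ)ᴴ *ᵥ y) (MultiIndex.incl hmn α)‖ ≤
      √(Real.exp (‖x‖ ^ 2)) *
        √(m.factorial * ((c * w ^ 2)⁻¹ * ((N : ℝ)⁻¹ * ∑ k, ‖y k‖ ^ 2))) := by
  set v := (pinv (fockMatrix p n fun k => p + z k)ᴴ)ᴴ *ᵥ y with hv
  have h1 : ∑ α : MultiIndex d m, ‖v (MultiIndex.incl hmn α)‖ ^ 2 ≤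
      m.factorial * ∑ α : MultiIndex d n, (‖v α‖ / sqrtFactorial α.1) ^ 2 := by
    calc ∑ α : MultiIndex d m, ‖v (MultiIndex.incl hmn α)‖ ^ 2
        ≤ ∑ α : MultiIndex d m, m.factorial *
          (‖v (MultiIndex.incl hmn α)‖ / sqrtFactorial (MultiIndex.incl hmn α).1) ^ 2 := by
          refine Finset.sum_le_sum fun α _ => ?_
          have h0 := sqrtFactorial_sq_le α.2
          have hpos := sqrtFactorial_pos α.1
          rw [show (MultiIndex.incl hmn α).1 = α.1 from rfl, div_pow, mul_div_assoc',
            le_div_iff₀ (by positivity), mul_comm]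
          gcongr
      _ = m.factorial * ∑ α ∈ Finset.univ.map ⟨_, MultiIndex.incl_injective hmn⟩,
          (‖v α‖ / sqrtFactorial α.1) ^ 2 := by
          rw [Finset.sum_map, Finset.mul_sum]; rfl
      _ ≤ _ := by
          gcongr
          exact Finset.subset_univ _
  refine (norm_sum_mul_le _ _ _).trans ?_
  have h2 := sum_norm_fockFun_sq_le p m x
  have h3 := h.sum_div_le hc hw hwz v
  have h4 := sum_norm_sq_leastSquares_le (fockMatrix p n fun k => p + z k) y
  rw [← hv] at h4
  have h5 : ∑ α : MultiIndex d m, ‖v (MultiIndex.incl hmn α)‖ ^ 2 ≤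
      m.factorial * ((c * w ^ 2)⁻¹ * ((N : ℝ)⁻¹ * ∑ k, ‖y k‖ ^ 2)) := by
    refine h1.trans ?_
    gcongr
    refine h3.trans ?_
    gcongr
  gcongr

/-! ### The deterministic error bound -/

/-- Analyticity is an open condition, and compactness of K makes it hold along all of K for ρ close
to 1. -/
lemma exists_dilation_analyticAt {d r : ℕ} {p : Cn d} {K : Set (Cn d)} (hK : IsCompact K)
    {f : Cn d → Cn r} (hf : AnalyticOnNhd ℂ f (translateSet p K)) :
    ∃ ρ : ℝ, 1 < ρ ∧ ∀ y ∈ K, AnalyticAt ℂ f (p + (ρ : ℂ) • y) := by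
  have h : ∀ᶠ ρ : ℝ in 𝓝 1, ∀ y ∈ K, AnalyticAt ℂ f (p + (ρ : ℂ) • y) := by
    refine hK.eventually_forall_of_forall_eventually fun y hy => ?_
    have hc : Continuous fun q : ℝ × Cn d => p + (q.1 : ℂ) • q.2 := by fun_prop
    refine (hc.tendsto (1, y)).eventually (IsOpen.mem_nhds (isOpen_analyticAt ℂ f) ?_)
    have := hf (p + y) ⟨y, hy, rfl⟩
    simpa using this
  obtain ⟨ρ, h1, h2⟩ := ((h.filter_mono nhdsWithin_le_nhds).and
    (eventually_mem_nhdsWithin (a := (1 : ℝ)) (s := Set.Ioi 1))).exists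
  exact ⟨ρ, h2, h1⟩

lemma norm_le_card_mul {r : ℕ} (y : Cn r) {B : ℝ} (h : ∀ i, ‖y i‖ ≤ B) : ‖y‖ ≤ r * B := by
  have e : y = ∑ i, EuclideanSpace.single i (y i) := by
    ext j
    simp [Finset.sum_apply, Pi.single_apply]
  calc ‖y‖ ≤ ∑ i, ‖EuclideanSpace.single i (y i)‖ := by
        conv_lhs => rw [e]
        exact norm_sum_le _ _
    _ ≤ ∑ _i : Fin r, B := Finset.sum_le_sum fun i _ => by simpa using h i
    _ = r * B := by simp

/-- The sample error is kept as a quadratic mean of gauges, not a supremum: for weakly convergent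
samples outside the support only the mean is controlled. -/
theorem exists_reconstruction_component_bound {d r : ℕ} (p : Cn d) {K : Set (Cn d)}
    (hK : IsAbsConvexCompactNhd K) {f : Cn d → Cn r}
    (hf : AnalyticOnNhd ℂ f (translateSet p K)) :
    ∃ C : ℝ, 0 < C ∧ ∀ (m n : ℕ) (hmn : m ≤ n) (N : ℕ) (z : Fin N → Cn d) (c : ℝ),
      (∀ k, z k ∈ K) → 0 < c → IsStableSample n z c → ∀ x ∈ K, ∀ i,
        ‖reconstruction hmn p f (fun k => p + z k) (p + x) i - f (p + x) i‖ ≤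
          C * (√(m.factorial : ℝ) * (√((N : ℝ)⁻¹ * ∑ k, gauge K (z k) ^ (2 * n)) / √c) +
            gauge K x ^ m) := by
  obtain ⟨ρ, hρ1, hρ⟩ := exists_dilation_analyticAt hK.isCompact hf
  have hwc : Continuous (fockWeight p) := (differentiable_fockWeight p).continuous
  have hwi : ∀ ρ : ℝ, Continuous fun y : Cn d => (fockWeight p ((ρ : ℂ) • y))⁻¹ := fun ρ =>
    (hwc.comp (by fun_prop)).inv₀ fun y => fockWeight_ne_zero p _
  obtain ⟨W, hW⟩ := hK.isCompact.exists_bound_of_continuousOn hwc.continuousOn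
  obtain ⟨V, hV⟩ := hK.isCompact.exists_bound_of_continuousOn (hwi 1).continuousOn
  obtain ⟨V', hV'⟩ := hK.isCompact.exists_bound_of_continuousOn (hwi ρ).continuousOn
  have hfc : ContinuousOn (fun y => f (p + (ρ : ℂ) • y)) K := fun y hy =>
    (ContinuousAt.comp (f := fun y => p + (ρ : ℂ) • y) (hρ y hy).continuousAt
      (by fun_prop)).continuousWithinAt
  obtain ⟨B, hB⟩ := hK.isCompact.exists_bound_of_continuousOn hfc
  obtain ⟨D, hD⟩ := hK.isCompact.exists_bound_of_continuousOn
    (f := fun x => √(Real.exp (‖p + x‖ ^ 2))) (by fun_prop)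
  have hW0 : 0 ≤ W := (norm_nonneg _).trans (hW 0 hK.zero_mem)
  have hV0 : 0 < V := (norm_pos_iff.2 (inv_ne_zero (fockWeight_ne_zero p _))).trans_le
    (hV 0 hK.zero_mem)
  have hV0' : 0 ≤ V' := (norm_nonneg _).trans (hV' 0 hK.zero_mem)
  have hB0 : 0 ≤ B := (norm_nonneg _).trans (hB 0 hK.zero_mem)
  have hD0 : 0 ≤ D := (norm_nonneg _).trans (hD 0 hK.zero_mem)
  -- A common bound for φ and ψ on ρK, free of m by `norm_coordApprox_le`; the added B covers the
  -- values of f itself.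
  set M := (√(Real.exp (B ^ 2)) * √(Real.exp 1) + B) * V' with hM
  have hM0 : 0 ≤ M := by positivity
  set A := W * (M * (1 - ρ⁻¹)⁻¹) with hA
  have hρi : 0 < 1 - ρ⁻¹ := sub_pos.2 (inv_lt_one_of_one_lt₀ hρ1)
  have hA0 : 0 ≤ A := by positivity
  -- A pays for the Taylor remainder of ψ at x and D·A·V for the propagated sample remainder; the 1
  -- keeps the constant positive.
  refine ⟨D * (A * V) + A + 1, by positivity, fun m n hmn N z c hz hc hst x hx i => ?_⟩
  let g : Cn d → ℂ := fun x => coordApprox (f p) m i (f (p + x))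
  let φ : Cn d → ℂ := fun x => g x * (fockWeight p x)⁻¹
  let ψ : Cn d → ℂ := fun x => f (p + x) i * (fockWeight p x)⁻¹
  have hfa : ∀ y, AnalyticAt ℂ f (p + y) → AnalyticAt ℂ (fun x => f (p + x)) y := fun y h =>
    AnalyticAt.fun_comp (g := f) h (by fun_prop)
  have hfi : ∀ y, AnalyticAt ℂ f (p + y) → AnalyticAt ℂ (fun x => f (p + x) i) y := fun y h =>
    AnalyticAt.fun_comp (g := fun w : Cn r => w i) (f := fun x => f (p + x))
      ((EuclideanSpace.proj i : Cn r →L[ℂ] ℂ).analyticAt _) (hfa y h)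
  have hwa : ∀ y, AnalyticAt ℂ (fun x => (fockWeight p x)⁻¹) y := fun y =>
    (analyticAt_fockWeight p y).fun_inv (fockWeight_ne_zero p y)
  have hφa : ∀ y, AnalyticAt ℂ f (p + y) → AnalyticAt ℂ φ y := fun y h =>
    (AnalyticAt.fun_comp (g := coordApprox (f p) m i) (f := fun x => f (p + x))
      (analyticAt_coordApprox (f p) m i _) (hfa y h)).fun_mul (hwa y)
  have hψa : ∀ y, AnalyticAt ℂ f (p + y) → AnalyticAt ℂ ψ y := fun y h =>
    (hfi y h).fun_mul (hwa y)
  have hφM : ∀ y ∈ K, ‖φ ((ρ : ℂ) • y)‖ ≤ M := fun y hy => by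
    rw [norm_mul]
    have h1 := norm_coordApprox_le (f p) m i (f (p + (ρ : ℂ) • y))
    have h2 := hB y hy
    have h3 := hV' y hy
    have h4 : ‖g ((ρ : ℂ) • y)‖ ≤ √(Real.exp (B ^ 2)) * √(Real.exp 1) + B := by
      refine h1.trans (le_add_of_le_of_nonneg ?_ hB0)
      gcongr
    rw [hM]
    gcongr
  have hψM : ∀ y ∈ K, ‖ψ ((ρ : ℂ) • y)‖ ≤ M := fun y hy => by
    rw [norm_mul]
    have h2 : ‖f (p + (ρ : ℂ) • y) i‖ ≤ √(Real.exp (B ^ 2)) * √(Real.exp 1) + B :=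
      (PiLp.norm_apply_le _ i).trans ((hB y hy).trans (le_add_of_nonneg_left (by positivity)))
    have h3 := hV' y hy
    rw [hM]
    gcongr
  have hf0 : AnalyticAt ℂ f (p + 0) := hf _ ⟨0, hK.zero_mem, rfl⟩
  -- The contact of order m + 1 at f(p) is pulled back along f(p + x) - f(p) = O(‖x‖), and 1/w is
  -- bounded near 0.
  have hO : (fun x => φ x - ψ x) =O[𝓝 0] fun x => ‖x‖ ^ (m + 1) := by
    have h1 : (fun x => f (p + x) - f p) =O[𝓝 0] fun x => x := by
      have := (hfa 0 hf0).differentiableAt.isBigO_sub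
      simpa using this
    have h2 : Tendsto (fun x => f (p + x)) (𝓝 0) (𝓝 (f p)) := by
      have := (hfa 0 hf0).continuousAt.tendsto
      simpa using this
    have h3 := ((coordApprox_sub_isBigO (f p) m i).comp_tendsto h2).trans (h1.norm_norm.pow (m + 1))
    have h4 : (fun x => (fockWeight p x)⁻¹) =O[𝓝 0] fun _ => (1 : ℝ) :=
      (hwa 0).continuousAt.tendsto.isBigO_one ℝ
    have h5 := h3.mul h4
    simp only [mul_one] at h5
    refine h5.congr_left fun x => ?_
    simp only [φ, ψ, g, Function.comp]
    ring
  obtain ⟨a, ha⟩ := exists_taylor_monomials (hφa 0 hf0)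
  have hm : ∑ α : MultiIndex d m, a α.1 * monomial x α.1 =
      ∑ k ∈ Finset.range (m + 1), homPart ψ k x := by
    rw [← ha]
    exact Finset.sum_congr rfl fun k hk =>
      homPart_congr_of_isBigO (hφa 0 hf0) (hψa 0 hf0) hO (Nat.lt_succ_iff.1 (Finset.mem_range.1 hk)) x
  -- The Fock coefficients of the degree n Taylor polynomial of φ. With y the weighted remainder at
  -- the samples, the data vector is U b + y.
  let b : MultiIndex d n → ℂ := fun α => a α.1 * sqrtFactorial α.1
  let y : Fin N → ℂ := fun k =>
    fockWeight p (z k) * (φ (z k) - ∑ j ∈ Finset.range (n + 1), homPart φ j (z k))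
  have hterm : ∀ (x : Cn d) (α : Fin d → ℕ), fockFun p α (p + x) * (a α * sqrtFactorial α) =
      fockWeight p x * (a α * monomial x α) := fun x α => by
    have : (sqrtFactorial α : ℂ) ≠ 0 := by exact_mod_cast (sqrtFactorial_pos α).ne'
    rw [fockFun_add]
    field_simp
  have hgk : (fun k => coordApprox (f p) m i (f (p + z k))) =
      fockMatrix p n (fun k => p + z k) *ᵥ b + y := by
    ext k
    have h1 : (fockMatrix p n (fun k => p + z k) *ᵥ b) k =
        fockWeight p (z k) * ∑ j ∈ Finset.range (n + 1), homPart φ j (z k) := by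
      rw [ha, Finset.mul_sum]
      exact Finset.sum_congr rfl fun α _ => hterm (z k) α.1
    rw [Pi.add_apply, h1]
    simp only [y, φ, g]
    have := fockWeight_ne_zero p (z k)
    field_simp
    ring
  -- The fit returns b unchanged, and by `hm` its part of degree ≤ m is the Taylor polynomial of ψ.
  -- Only y is passed through the pseudo-inverse.
  have hrec : reconstruction hmn p f (fun k => p + z k) (p + x) i - f (p + x) i =
      fockWeight p x * -(ψ x - ∑ k ∈ Finset.range (m + 1), homPart ψ k x) +
      ∑ α : MultiIndex d m, fockFun p α.1 (p + x) *
        ((pinv (fockMatrix p n fun k => p + z k)ᴴ)ᴴ *ᵥ y) (MultiIndex.incl hmn α) := by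
    rw [reconstruction_apply, hgk, Matrix.mulVec_add,
      leastSquares_mulVec (hst.injective hc p)]
    simp only [Pi.add_apply, mul_add, Finset.sum_add_distrib]
    have h1 : ∑ α : MultiIndex d m, fockFun p α.1 (p + x) * b (MultiIndex.incl hmn α) =
        fockWeight p x * ∑ k ∈ Finset.range (m + 1), homPart ψ k x := by
      rw [← hm, Finset.mul_sum]
      exact Finset.sum_congr rfl fun α _ => hterm x α.1
    have h2 : f (p + x) i = fockWeight p x * ψ x := by
      simp only [ψ]
      have := fockWeight_ne_zero p x
      field_simp
    rw [h1, h2]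
    ring
  have hE1 : ‖fockWeight p x * -(ψ x - ∑ k ∈ Finset.range (m + 1), homPart ψ k x)‖ ≤
      A * gauge K x ^ m := by
    rw [norm_mul, norm_neg]
    have h1 := hK.norm_sub_taylor_le hρ1 (fun y hy => hψa _ (hρ y hy)) hψM hx m
    have h2 := hW x hx
    have hg0 := gauge_nonneg (s := K) x
    calc _ ≤ W * (M * (1 - ρ⁻¹)⁻¹ * gauge K x ^ m) := by gcongr
      _ = _ := by rw [hA]; ring
  have hy : ∀ k, ‖y k‖ ^ 2 ≤ A ^ 2 * gauge K (z k) ^ (2 * n) := fun k => by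
    have h1 := hK.norm_sub_taylor_le hρ1 (fun y hy => hφa _ (hρ y hy)) hφM (hz k) n
    have h2 := hW (z k) (hz k)
    have hg0 := gauge_nonneg (s := K) (z k)
    have : ‖y k‖ ≤ A * gauge K (z k) ^ n := by
      simp only [y]
      rw [norm_mul]
      calc _ ≤ W * (M * (1 - ρ⁻¹)⁻¹ * gauge K (z k) ^ n) := by gcongr
        _ = _ := by rw [hA]; ring
    calc ‖y k‖ ^ 2 ≤ (A * gauge K (z k) ^ n) ^ 2 := by gcongr
      _ = _ := by ring
  have hwz : ∀ k, V⁻¹ ≤ ‖fockWeight p (z k)‖ := fun k => by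
    have h1 := hV (z k) (hz k)
    rw [norm_inv, Complex.ofReal_one, one_smul] at h1
    exact inv_le_of_inv_le₀ (norm_pos_iff.2 (fockWeight_ne_zero p _)) h1
  set S := (N : ℝ)⁻¹ * ∑ k, gauge K (z k) ^ (2 * n) with hS
  have hS0 : 0 ≤ S := mul_nonneg (by positivity)
    (Finset.sum_nonneg fun k _ => pow_nonneg (gauge_nonneg _) _)
  have hE2 := hst.norm_truncated_le hmn hc (inv_pos.2 hV0) hwz y (p + x)
  clear_value A
  have hE3 : √(m.factorial * ((c * V⁻¹ ^ 2)⁻¹ * ((N : ℝ)⁻¹ * ∑ k, ‖y k‖ ^ 2))) ≤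
      A * V * (√(m.factorial : ℝ) * (√S / √c)) := by
    have h1 : (N : ℝ)⁻¹ * ∑ k, ‖y k‖ ^ 2 ≤ A ^ 2 * S := by
      rw [hS, mul_left_comm, Finset.mul_sum (a := A ^ 2)]
      exact mul_le_mul_of_nonneg_left (Finset.sum_le_sum fun k _ => hy k) (by positivity)
    refine Real.sqrt_le_iff.2 ⟨by positivity, ?_⟩
    calc m.factorial * ((c * V⁻¹ ^ 2)⁻¹ * ((N : ℝ)⁻¹ * ∑ k, ‖y k‖ ^ 2))
        ≤ m.factorial * ((c * V⁻¹ ^ 2)⁻¹ * (A ^ 2 * S)) := by gcongr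
      _ = _ := by
          rw [mul_pow, mul_pow, mul_pow, div_pow, Real.sq_sqrt (by positivity), Real.sq_sqrt hS0,
            Real.sq_sqrt hc.le]
          field_simp
  have hDx := hD x hx
  rw [Real.norm_of_nonneg (Real.sqrt_nonneg _)] at hDx
  have hg0 : 0 ≤ gauge K x ^ m := pow_nonneg (gauge_nonneg x) m
  have hT0 : 0 ≤ √(m.factorial : ℝ) * (√S / √c) := by positivity
  have hE4 : ‖∑ α : MultiIndex d m, fockFun p α.1 (p + x) *
      ((pinv (fockMatrix p n fun k => p + z k)ᴴ)ᴴ *ᵥ y) (MultiIndex.incl hmn α)‖ ≤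
      D * (A * V * (√(m.factorial : ℝ) * (√S / √c))) :=
    hE2.trans (mul_le_mul hDx hE3 (Real.sqrt_nonneg _) hD0)
  rw [hrec]
  refine (norm_add_le _ _).trans ((add_le_add hE1 hE4).trans ?_)
  have := mul_nonneg hA0 hT0
  have := mul_nonneg (mul_nonneg hD0 (mul_nonneg hA0 hV0.le)) hg0
  nlinarith

/-- The error bound for a stable sample: the approximation error at the sample points and the
truncation error on `K₁`. -/
theorem exists_uniformError_bound {d r : ℕ} (p : Cn d) {K : Set (Cn d)}
    (hK : IsAbsConvexCompactNhd K) {f : Cn d → Cn r}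
    (hf : AnalyticOnNhd ℂ f (translateSet p K)) {K₁ : Set (Cn d)} (hK₁ : K₁ ⊆ K) :
    ∃ C : ℝ, 0 < C ∧ ∀ (m n : ℕ) (hmn : m ≤ n) (N : ℕ) (z : Fin N → Cn d) (c : ℝ),
      (∀ k, z k ∈ K) → 0 < c → IsStableSample n z c →
        uniformError (reconstruction hmn p f (fun k => p + z k)) f (translateSet p K₁) ≤
          ENNReal.ofReal (C *
            (√(m.factorial : ℝ) * (√((N : ℝ)⁻¹ * ∑ k, gauge K (z k) ^ (2 * n)) / √c) +
              radius K K₁ ^ m)) := by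
  obtain ⟨C, hC, h⟩ := exists_reconstruction_component_bound p hK hf
  refine ⟨(r + 1) * C, by positivity, fun m n hmn N z c hz hc hst => ?_⟩
  refine iSup₂_le ?_
  rintro _ ⟨x, hx, rfl⟩
  rw [← ofReal_norm]
  refine ENNReal.ofReal_le_ofReal ?_
  have h0 : 0 ≤ √(m.factorial : ℝ) * (√((N : ℝ)⁻¹ * ∑ k, gauge K (z k) ^ (2 * n)) / √c) := by
    positivity
  have hr := hK.radius_nonneg K₁
  have hg := hK.gauge_le_radius hK₁ hx
  have hgm : gauge K x ^ m ≤ radius K K₁ ^ m := pow_le_pow_left₀ (gauge_nonneg x) hg m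
  refine (norm_le_card_mul _ fun i => (h m n hmn N z c hz hc hst x (hK₁ hx) i).trans
    (mul_le_mul_of_nonneg_left (add_le_add_right hgm _) hC.le)).trans ?_
  have := mul_nonneg hC.le (add_nonneg h0 (pow_nonneg hr m))
  linarith

/-! ### Quadratic forms of Hermitian matrices -/

section QuadraticForm

variable {ι : Type*} [Fintype ι]

/-- The real part of `v^* A v`. -/
def quadForm (A : Matrix ι ι ℂ) (v : ι → ℂ) : ℝ := (star v ⬝ᵥ A *ᵥ v).re

lemma quadForm_sub (A B : Matrix ι ι ℂ) (v : ι → ℂ) :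
    quadForm (A - B) v = quadForm A v - quadForm B v := by
  simp [quadForm, Matrix.sub_mulVec, dotProduct_sub]

lemma quadForm_conj {S : Matrix ι ι ℂ} (hS : Sᴴ = S) (A : Matrix ι ι ℂ) (v : ι → ℂ) :
    quadForm (S * A * S) v = quadForm A (S *ᵥ v) := by
  rw [quadForm, quadForm, Matrix.star_mulVec, hS, ← Matrix.dotProduct_mulVec, Matrix.mulVec_mulVec,
    Matrix.mulVec_mulVec, Matrix.mul_assoc]

lemma quadForm_eq_sum (A : Matrix ι ι ℂ) (v : ι → ℂ) :
    quadForm A v = (∑ q : ι × ι, A q.1 q.2 * (conj (v q.1) * v q.2)).re := by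
  rw [quadForm, Fintype.sum_prod_type]
  congr 1
  simp only [dotProduct, Matrix.mulVec, Pi.star_apply, RCLike.star_def, Finset.mul_sum]
  exact Finset.sum_congr rfl fun i _ => Finset.sum_congr rfl fun j _ => by ring

/-- Cauchy–Schwarz over the entries: the array conj(v_i) v_j has Euclidean norm ‖v‖². -/
lemma abs_quadForm_le_of_frobenius {A : Matrix ι ι ℂ} {t : ℝ} (ht : 0 ≤ t)
    (hA : ∑ q : ι × ι, ‖A q.1 q.2‖ ^ 2 ≤ t ^ 2) (v : ι → ℂ) :
    |quadForm A v| ≤ t * ∑ i, ‖v i‖ ^ 2 := by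
  rw [quadForm_eq_sum]
  refine (Complex.abs_re_le_norm _).trans ((norm_sum_mul_le _ _ _).trans ?_)
  have h1 : ∑ q : ι × ι, ‖conj (v q.1) * v q.2‖ ^ 2 = (∑ i, ‖v i‖ ^ 2) ^ 2 := by
    rw [Fintype.sum_prod_type, sq, Finset.sum_mul_sum]
    simp [mul_pow]
  have h0 : 0 ≤ ∑ i, ‖v i‖ ^ 2 := Finset.sum_nonneg fun _ _ => by positivity
  rw [h1, Real.sqrt_sq h0]
  gcongr
  exact (Real.sqrt_le_left ht).2 hA

lemma quadForm_le_opNorm [DecidableEq ι] (A : Matrix ι ι ℂ) (v : ι → ℂ) :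
    quadForm A v ≤ opNorm A * ∑ i, ‖v i‖ ^ 2 := by
  set x : EuclideanSpace ℂ ι := WithLp.toLp 2 v with hx
  have h1 : star v ⬝ᵥ A *ᵥ v = inner ℂ x (Matrix.toEuclideanCLM (n := ι) (𝕜 := ℂ) A x) := by
    rw [EuclideanSpace.inner_eq_star_dotProduct, hx, Matrix.ofLp_toEuclideanCLM, dotProduct_comm]
  have h2 : ∑ i, ‖v i‖ ^ 2 = ‖x‖ * ‖x‖ := by
    rw [← sq, EuclideanSpace.norm_sq_eq]
  rw [quadForm, h1, h2]
  refine (Complex.re_le_norm _).trans ((norm_inner_le_norm _ _).trans ?_)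
  have := (Matrix.toEuclideanCLM (n := ι) (𝕜 := ℂ) A).le_opNorm x
  calc _ ≤ ‖x‖ * (opNorm A * ‖x‖) := by unfold opNorm; gcongr
    _ = _ := by ring

lemma quadForm_one [DecidableEq ι] (v : ι → ℂ) : quadForm 1 v = ∑ i, ‖v i‖ ^ 2 := by
  rw [quadForm, Matrix.one_mulVec, star_dotProduct_self, Complex.ofReal_re]

open scoped MatrixOrder ComplexOrder in
lemma mul_sum_le_quadForm [DecidableEq ι] {A : Matrix ι ι ℂ} (hA : A.IsHermitian) {c : ℝ}
    (hc : ∀ i, c ≤ hA.eigenvalues i) (v : ι → ℂ) : c * ∑ i, ‖v i‖ ^ 2 ≤ quadForm A v := by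
  have h1 : algebraMap ℝ (Matrix ι ι ℂ) c ≤ A := by
    rw [algebraMap_le_iff_le_spectrum (ha := hA.isSelfAdjoint), hA.spectrum_real_eq_range_eigenvalues]
    rintro _ ⟨i, rfl⟩
    exact hc i
  have h2 := (Matrix.le_iff.1 h1).re_dotProduct_nonneg v
  have h3 : quadForm (algebraMap ℝ (Matrix ι ι ℂ) c) v = c * ∑ i, ‖v i‖ ^ 2 := by
    rw [← quadForm_one, quadForm, quadForm, Algebra.algebraMap_eq_smul_one, Matrix.smul_mulVec,
      dotProduct_smul, Complex.smul_re, smul_eq_mul]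
  change 0 ≤ quadForm _ v at h2
  rw [quadForm_sub, h3] at h2
  linarith

open scoped ComplexOrder in
lemma posSemidef_of_quadForm {A : Matrix ι ι ℂ} (hA : A.IsHermitian)
    (h : ∀ v, 0 ≤ quadForm A v) : A.PosSemidef := by
  refine Matrix.PosSemidef.of_dotProduct_mulVec_nonneg hA fun v => ?_
  rw [Complex.le_def]
  refine ⟨h v, ?_⟩
  have h1 : star (star v ⬝ᵥ A *ᵥ v) = star v ⬝ᵥ A *ᵥ v := by
    rw [← Matrix.star_dotProduct_star, star_star, Matrix.star_mulVec, hA.eq, ← Matrix.dotProduct_mulVec]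
  exact (Complex.conj_eq_iff_im.1 h1).symm

open scoped ComplexOrder in
-- Tested on A^{1/2}v, the two factors A^{-1/2} cancel and the hypothesis reads v^*Av - v^*Bv ≤ (1 -
-- γ) v^*Av.
lemma quadForm_le_of_opNorm_one_sub [DecidableEq ι] {A B : Matrix ι ι ℂ} (hA : A.PosDef) {γ : ℝ}
    (h : opNorm (1 - invSqrt A * B * invSqrt A) ≤ 1 - γ) (v : ι → ℂ) :
    γ * quadForm A v ≤ quadForm B v := by
  have hsa : IsSelfAdjoint A := hA.1.isSelfAdjoint
  have hc : ∀ g : ℝ → ℝ, ContinuousOn g (spectrum ℝ A) := fun g =>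
    Matrix.finite_real_spectrum.continuousOn g
  have hpos : ∀ t ∈ spectrum ℝ A, 0 < t := by
    rw [hA.1.spectrum_real_eq_range_eigenvalues]
    rintro _ ⟨i, rfl⟩
    exact hA.eigenvalues_pos i
  set S := invSqrt A with hS
  set T := cfc (fun t : ℝ => √t) A with hT
  have hSh : Sᴴ = S := (cfc_predicate (fun t : ℝ => (√t)⁻¹) A : IsSelfAdjoint _)
  have hTh : Tᴴ = T := (cfc_predicate (fun t : ℝ => √t) A : IsSelfAdjoint _)
  have hST : S * T = 1 := by
    rw [hS, hT, invSqrt, ← cfc_mul _ _ A (hc _) (hc _), ← cfc_one ℝ A hsa]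
    exact cfc_congr fun t ht => inv_mul_cancel₀ (Real.sqrt_pos.2 (hpos t ht)).ne'
  have hTT : T * T = A := by
    conv_rhs => rw [← cfc_id ℝ A hsa]
    rw [hT, ← cfc_mul _ _ A (hc _) (hc _)]
    exact cfc_congr fun t ht => Real.mul_self_sqrt (hpos t ht).le
  have h1 := quadForm_le_opNorm (1 - S * B * S) (T *ᵥ v)
  have h2 : ∑ i, ‖(T *ᵥ v) i‖ ^ 2 = quadForm A v := by
    rw [← quadForm_one, ← quadForm_conj hTh, Matrix.mul_one, hTT]
  have h3 : quadForm (S * B * S) (T *ᵥ v) = quadForm B v := by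
    rw [quadForm_conj hSh, Matrix.mulVec_mulVec, hST, Matrix.one_mulVec]
  rw [quadForm_sub, quadForm_one, h2, h3] at h1
  have h4 : 0 ≤ quadForm A v := by
    rw [← h2]
    exact Finset.sum_nonneg fun _ _ => by positivity
  have := mul_le_mul_of_nonneg_right h h4
  linarith

end QuadraticForm

/-! ### Moment matrices -/

section Moments

variable {d n : ℕ}

instance : Nonempty (MultiIndex d n) := ⟨⟨0, by simp⟩⟩

lemma continuous_monomial (α : Fin d → ℕ) : Continuous fun x : Cn d => monomial x α :=
  (differentiable_monomial α).continuous

lemma integrable_of_continuous {E : Type*} [NormedAddCommGroup E] {K : Set (Cn d)}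
    (hK : IsCompact K) {μ : Measure (Cn d)} [IsFiniteMeasure μ] (hμ : μ Kᶜ = 0)
    {g : Cn d → E} (hg : Continuous g) [SecondCountableTopology E] : Integrable g μ := by
  obtain ⟨B, hB⟩ := hK.exists_bound_of_continuousOn hg.continuousOn
  refine Integrable.of_bound hg.aestronglyMeasurable B ?_
  have : ∀ᵐ x ∂μ, x ∈ K := by
    rw [ae_iff]; exact hμ
  filter_upwards [this] with x hx using hB x hx

lemma re_sum_moments (v : MultiIndex d n → ℂ) (x : Cn d) :
    ‖∑ α, v α * monomial x α.1‖ ^ 2 = (∑ q : MultiIndex d n × MultiIndex d n,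
      conj (monomial x q.1.1) * monomial x q.2.1 * (conj (v q.1) * v q.2)).re := by
  have h : ((‖∑ α, v α * monomial x α.1‖ ^ 2 : ℝ) : ℂ) = ∑ q : MultiIndex d n × MultiIndex d n,
      conj (monomial x q.1.1) * monomial x q.2.1 * (conj (v q.1) * v q.2) := by
    push_cast
    rw [← Complex.conj_mul', map_sum, Finset.sum_mul_sum, Fintype.sum_prod_type]
    refine Finset.sum_congr rfl fun i _ => Finset.sum_congr rfl fun j _ => ?_
    rw [map_mul]
    ring
  rw [← h, Complex.ofReal_re]

lemma quadForm_momentMatrix {K : Set (Cn d)} (hK : IsCompact K) {μ : Measure (Cn d)}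
    [IsFiniteMeasure μ] (hμ : μ Kᶜ = 0) (v : MultiIndex d n → ℂ) :
    quadForm (momentMatrix n μ) v = ∫ x, ‖∑ α, v α * monomial x α.1‖ ^ 2 ∂μ := by
  have hi : ∀ q : MultiIndex d n × MultiIndex d n, Integrable (fun x : Cn d =>
      conj (monomial x q.1.1) * monomial x q.2.1 * (conj (v q.1) * v q.2)) μ := fun q => by
    have h1 := continuous_monomial q.1.1
    have h2 := continuous_monomial q.2.1
    exact integrable_of_continuous hK hμ
      (((Complex.continuous_conj.comp h1).mul h2).mul continuous_const)
  simp only [re_sum_moments]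
  have := integral_re (integrable_finsetSum Finset.univ fun q _ => hi q)
  simp only [RCLike.re_to_complex] at this
  rw [this, quadForm_eq_sum, integral_finsetSum _ fun q _ => hi q]
  congr 1
  refine Finset.sum_congr rfl fun q _ => ?_
  rw [integral_mul_const]
  rfl

lemma momentMatrix_empirical {N : ℕ} (z : Fin N → Cn d) (α β : MultiIndex d n) :
    momentMatrix n (empiricalMeasure z) α β =
      (N : ℂ)⁻¹ * ∑ k, conj (monomial (z k) α.1) * monomial (z k) β.1 := by
  simp only [momentMatrix, empiricalMeasure, Matrix.of_apply]
  rw [integral_smul_measure, integral_finsetSum_measure fun k _ => by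
    exact integrable_dirac (by finiteness)]
  simp [Complex.real_smul]

lemma quadForm_momentMatrix_empirical {N : ℕ} (z : Fin N → Cn d) (v : MultiIndex d n → ℂ) :
    quadForm (momentMatrix n (empiricalMeasure z)) v =
      (N : ℝ)⁻¹ * ∑ k, ‖∑ α, v α * monomial (z k) α.1‖ ^ 2 := by
  simp only [re_sum_moments]
  rw [quadForm_eq_sum, ← Complex.re_sum, ← Complex.re_ofReal_mul, Finset.sum_comm, Finset.mul_sum]
  congr 1
  refine Finset.sum_congr rfl fun q _ => ?_
  rw [momentMatrix_empirical, ← Finset.sum_mul]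
  push_cast
  ring

lemma isStableSample_of_quadForm {N : ℕ} {z : Fin N → Cn d} {c : ℝ}
    (h : ∀ v, c * ∑ α, ‖v α‖ ^ 2 ≤ quadForm (momentMatrix n (empiricalMeasure z)) v) :
    IsStableSample n z c := fun v => by
  rw [← quadForm_momentMatrix_empirical]
  exact h v

lemma smallestEigenvalue_mul_le (n : ℕ) (μ : Measure (Cn d)) (v : MultiIndex d n → ℂ) :
    smallestEigenvalue n μ * ∑ α, ‖v α‖ ^ 2 ≤ quadForm (momentMatrix n μ) v :=
  mul_sum_le_quadForm (momentMatrix_isHermitian n μ)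
    (fun i => ciInf_le (Set.finite_range _).bddBelow i) v

open scoped ComplexOrder in
lemma smallestEigenvalue_pos {μ : Measure (Cn d)} (h : (momentMatrix n μ).PosDef) :
    0 < smallestEigenvalue n μ := by
  obtain ⟨i, hi⟩ := exists_eq_ciInf_of_finite
    (f := fun α => (momentMatrix_isHermitian n μ).eigenvalues α)
  rw [smallestEigenvalue, ← hi]
  exact h.eigenvalues_pos i

open scoped ComplexOrder in
lemma posDef_of_isUnit {K : Set (Cn d)} (hK : IsCompact K) {μ : Measure (Cn d)}
    [IsFiniteMeasure μ] (hμ : μ Kᶜ = 0) (hu : IsUnit (momentMatrix n μ)) :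
    (momentMatrix n μ).PosDef := by
  have h := posSemidef_of_quadForm (momentMatrix_isHermitian n μ) fun v => by
    rw [quadForm_momentMatrix hK hμ]
    exact integral_nonneg fun x => by positivity
  exact h.posDef_iff_isUnit.2 hu

/-- The empirical form differs from one bounded below by Λ‖v‖² by at most (1 - γ)Λ‖v‖². -/
lemma isStableSample_of_frobenius {N : ℕ} {z : Fin N → Cn d} {μ : Measure (Cn d)} {γ : ℝ}
    (hγ : γ ≤ 1) (hΛ : 0 ≤ smallestEigenvalue n μ)
    (h : ∑ q : MultiIndex d n × MultiIndex d n,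
      ‖(momentMatrix n (empiricalMeasure z) - momentMatrix n μ) q.1 q.2‖ ^ 2 ≤
        ((1 - γ) * smallestEigenvalue n μ) ^ 2) :
    IsStableSample n z (γ * smallestEigenvalue n μ) := by
  refine isStableSample_of_quadForm fun v => ?_
  have h1 := abs_quadForm_le_of_frobenius (mul_nonneg (sub_nonneg.2 hγ) hΛ) h v
  have h2 := smallestEigenvalue_mul_le n μ v
  rw [quadForm_sub, abs_le] at h1
  nlinarith [h1.1]

/-! ### Absolutely continuous measures -/

lemma measurePreserving_finSucc_swap (d : ℕ) :
    MeasurePreserving (fun x : Fin (d + 1) → ℝ => ((fun i => x (Fin.succ i), x 0) : (Fin d → ℝ) × ℝ))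
      := by
  have h := (Measure.measurePreserving_swap (μ := (volume : Measure ℝ))
    (ν := (volume : Measure (Fin d → ℝ)))).comp
    (volume_preserving_piFinSuccAbove (fun _ : Fin (d + 1) => ℝ) 0)
  exact h

/-- Induction by Fubini, splitting off the variable 0. The leading coefficient in it is a polynomial
in the others, nonzero almost everywhere by induction; there the section of the zero set is a finite
set of roots. -/
lemma volume_zeros_mvPolynomial (d : ℕ) (P : MvPolynomial (Fin d) ℂ) (hP : P ≠ 0) :
    volume {x : Fin d → ℝ | MvPolynomial.eval (fun i => (x i : ℂ)) P = 0} = 0 := by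
  induction d with
  | zero =>
    rw [MvPolynomial.eq_C_of_isEmpty P] at hP ⊢
    have : MvPolynomial.coeff 0 P ≠ 0 := fun h => hP (by rw [h, MvPolynomial.C_0])
    simp [this]
  | succ d ih =>
    set Q := MvPolynomial.finSuccEquiv ℂ d P with hQ
    have hQ0 : Q ≠ 0 := by simpa [hQ] using hP
    let s : Set ((Fin d → ℝ) × ℝ) := {q | MvPolynomial.eval
      (Fin.cons (q.2 : ℂ) (fun i => (q.1 i : ℂ)) : Fin (d + 1) → ℂ) P = 0}
    have hcont : Continuous fun q : (Fin d → ℝ) × ℝ =>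
        (Fin.cons (q.2 : ℂ) (fun i => (q.1 i : ℂ)) : Fin (d + 1) → ℂ) := by
      refine continuous_pi fun i => ?_
      refine Fin.cases ?_ (fun i => ?_) i
      · simp only [Fin.cons_zero]; fun_prop
      · simp only [Fin.cons_succ]; fun_prop
    have hs : MeasurableSet s :=
      (isClosed_singleton.preimage ((MvPolynomial.continuous_eval P).comp hcont)).measurableSet
    have hnull : (volume : Measure ((Fin d → ℝ) × ℝ)) s = 0 := by
      rw [Measure.volume_eq_prod, Measure.measure_prod_null hs]
      have h1 := ih Q.leadingCoeff (Polynomial.leadingCoeff_ne_zero.2 hQ0)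
      have h2 : ∀ᵐ y : Fin d → ℝ, MvPolynomial.eval (fun i => (y i : ℂ)) Q.leadingCoeff ≠ 0 := by
        rw [ae_iff]
        simpa using h1
      filter_upwards [h2] with y hy
      set R := Polynomial.map (MvPolynomial.eval fun i => (y i : ℂ)) Q with hR
      have hR0 : R ≠ 0 := fun h => hy (by
        have := congrArg (fun p => Polynomial.coeff p Q.natDegree) h
        simpa [hR, Polynomial.coeff_map] using this)
      refine Set.Finite.measure_zero ?_ _
      refine Set.Finite.subset ((Polynomial.finite_setOfPred_isRoot hR0).preimage
        (Complex.ofReal_injective.injOn)) fun t ht => ?_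
      have ht' : MvPolynomial.eval (Fin.cons (t : ℂ) (fun i => (y i : ℂ)) : Fin (d + 1) → ℂ) P = 0 :=
        ht
      rw [MvPolynomial.eval_eq_eval_mv_eval'] at ht'
      exact ht'
    have := (measurePreserving_finSucc_swap d).quasiMeasurePreserving.preimage_null hnull
    refine measure_mono_null (fun x hx => ?_) this
    have e : (Fin.cons (x 0 : ℂ) (fun i => (x (Fin.succ i) : ℂ)) : Fin (d + 1) → ℂ) =
        fun i => (x i : ℂ) := by
      refine funext fun i => ?_
      refine Fin.cases ?_ (fun i => ?_) i <;> simp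
    change MvPolynomial.eval (Fin.cons (x 0 : ℂ) (fun i => (x (Fin.succ i) : ℂ)) :
      Fin (d + 1) → ℂ) P = 0
    rw [e]
    exact hx

lemma continuous_ofRealVec : Continuous (ofRealVec (d := d)) := by
  unfold ofRealVec
  fun_prop

/-- The polynomial with coefficients `v`. -/
def toMvPolynomial (v : MultiIndex d n → ℂ) : MvPolynomial (Fin d) ℂ :=
  ∑ α, MvPolynomial.monomial (Finsupp.equivFunOnFinite.symm α.1) (v α)

lemma eval_toMvPolynomial (v : MultiIndex d n → ℂ) (x : Cn d) :
    MvPolynomial.eval (fun i => x i) (toMvPolynomial v) = ∑ α, v α * monomial x α.1 := by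
  simp only [toMvPolynomial, map_sum, MvPolynomial.eval_monomial, monomial]
  refine Finset.sum_congr rfl fun α _ => ?_
  rw [Finsupp.prod_fintype _ _ (by simp)]
  simp

lemma toMvPolynomial_ne_zero {v : MultiIndex d n → ℂ} (hv : v ≠ 0) : toMvPolynomial v ≠ 0 := by
  classical
  obtain ⟨α, hα⟩ := Function.ne_iff.1 hv
  intro h
  apply hα
  have h1 := congrArg (MvPolynomial.coeff (Finsupp.equivFunOnFinite.symm α.1)) h
  simp only [toMvPolynomial, MvPolynomial.coeff_sum, MvPolynomial.coeff_monomial,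
    EmbeddingLike.apply_eq_iff_eq, MvPolynomial.coeff_zero, Subtype.val_inj] at h1
  simpa using h1

lemma ae_sum_monomial_ne_zero {ν : Measure (EuclideanSpace ℝ (Fin d))} (hν : ν ≪ volume)
    {v : MultiIndex d n → ℂ} (hv : v ≠ 0) :
    ∀ᵐ x ∂ν, ∑ α, v α * monomial (ofRealVec x) α.1 ≠ 0 := by
  suffices h : ∀ᵐ x : EuclideanSpace ℝ (Fin d), ∑ α, v α * monomial (ofRealVec x) α.1 ≠ 0 from
    hν.ae_le h
  have h1 := volume_zeros_mvPolynomial d _ (toMvPolynomial_ne_zero hv)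
  have h2 := (PiLp.volume_preserving_ofLp (Fin d)).quasiMeasurePreserving.preimage_null h1
  rw [ae_iff]
  refine measure_mono_null (fun x hx => ?_) h2
  simp only [not_not, Set.mem_ofPred_eq, ← eval_toMvPolynomial] at hx
  exact hx

open scoped ComplexOrder in
-- A nonzero v with v^*Dv = 0 would give a nonzero polynomial with vanishing L² norm, hence one
-- vanishing almost everywhere on ℝ^d.
lemma posDef_of_absolutelyContinuous {ν : Measure (EuclideanSpace ℝ (Fin d))}
    [IsProbabilityMeasure ν] (hν : ν ≪ volume) {K : Set (Cn d)} (hK : IsCompact K)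
    (hνK : (ν.map ofRealVec) Kᶜ = 0) (n : ℕ) : (momentMatrix n (ν.map ofRealVec)).PosDef := by
  have hm : Measurable (ofRealVec (d := d)) := continuous_ofRealVec.measurable
  have : IsProbabilityMeasure (ν.map ofRealVec) :=
    Measure.isProbabilityMeasure_map hm.aemeasurable
  have hps := posSemidef_of_quadForm (momentMatrix_isHermitian n (ν.map ofRealVec)) fun v => by
    rw [quadForm_momentMatrix hK hνK]
    exact integral_nonneg fun x => by positivity
  refine Matrix.PosDef.of_dotProduct_mulVec_pos hps.1 fun v hv => ?_
  refine lt_of_le_of_ne (hps.dotProduct_mulVec_nonneg v) fun h0 => ?_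
  have h1 : quadForm (momentMatrix n (ν.map ofRealVec)) v = 0 := by
    rw [quadForm, ← h0, Complex.zero_re]
  have hc : Continuous fun x : Cn d => ‖∑ α, v α * monomial x α.1‖ ^ 2 := by
    have := fun α : MultiIndex d n => continuous_monomial α.1
    fun_prop
  rw [quadForm_momentMatrix hK hνK, integral_eq_zero_iff_of_nonneg (fun x => by positivity)
    (integrable_of_continuous hK hνK hc)] at h1
  have h2 := ae_of_ae_map hm.aemeasurable h1
  obtain ⟨x, hx1, hx2⟩ := (h2.and (ae_sum_monomial_ne_zero hν hv)).exists
  exact hx2 (by simpa using hx1)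

end Moments

/-! ### Hoeffding's inequality in a Hilbert space -/

/-- The function u ↦ cosh √u is a power series with nonnegative coefficients, hence convex on u ≥ 0.
-/
lemma cosh_sqrt_le {θ : ℝ} (h0 : 0 ≤ θ) (h1 : θ ≤ 1) (x y : ℝ) :
    Real.cosh √((1 - θ) * x ^ 2 + θ * y ^ 2) ≤ (1 - θ) * Real.cosh x + θ * Real.cosh y := by
  have hu : 0 ≤ (1 - θ) * x ^ 2 + θ * y ^ 2 :=
    add_nonneg (mul_nonneg (sub_nonneg.2 h1) (sq_nonneg x)) (mul_nonneg h0 (sq_nonneg y))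
  refine hasSum_le (fun n => ?_) (Real.hasSum_cosh _)
    (((Real.hasSum_cosh x).mul_left (1 - θ)).add ((Real.hasSum_cosh y).mul_left θ))
  rw [pow_mul, Real.sq_sqrt hu, pow_mul, pow_mul]
  have hc := (convexOn_pow (𝕜 := ℝ) n).2 (Set.mem_Ici.2 (sq_nonneg x)) (Set.mem_Ici.2 (sq_nonneg y))
    (sub_nonneg.2 h1) h0 (by ring)
  simp only [smul_eq_mul] at hc
  rw [mul_div_assoc', mul_div_assoc', ← add_div]
  gcongr

section Hilbert

variable {H : Type*} [NormedAddCommGroup H] [InnerProductSpace ℝ H]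

/-- The bound is affine in ⟨s, x⟩, so only cosh ‖s‖ cosh b survives integration against a centred
law. With a = ‖s‖ and c = ⟨s, x⟩, the number a² + b² + 2c bounds ‖s + x‖² and is the mixture of (a -
b)² and (a + b)² with weight θ; then `cosh_sqrt_le` applies. -/
lemma cosh_norm_add_le {s x : H} {b : ℝ} (hx : ‖x‖ ≤ b) :
    Real.cosh ‖s + x‖ ≤ Real.cosh ‖s‖ * Real.cosh b +
      Real.sinh ‖s‖ * Real.sinh b / (‖s‖ * b) * inner ℝ s x := by
  -- If s = 0 or b = 0, the coefficient of the inner product is a division by zero, equal to 0.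
  rcases eq_or_ne s 0 with rfl | hs
  · have : Real.cosh ‖x‖ ≤ Real.cosh b :=
      Real.cosh_le_cosh.2 (by simpa using hx.trans (le_abs_self b))
    simpa using this
  have hb0 : 0 ≤ b := (norm_nonneg x).trans hx
  rcases hb0.eq_or_lt with rfl | hb
  · have : x = 0 := norm_le_zero_iff.1 hx
    simp [this]
  have ha : 0 < ‖s‖ := norm_pos_iff.2 hs
  set a := ‖s‖ with haD
  set c : ℝ := inner ℝ s x with hc
  have hcab : |c| ≤ a * b := (abs_real_inner_le_norm s x).trans (by gcongr)
  have hab : 0 < a * b := mul_pos ha hb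
  obtain ⟨h1, h2⟩ := abs_le.1 hcab
  set θ : ℝ := (1 + c / (a * b)) / 2 with hθ
  have hq1 : -1 ≤ c / (a * b) := by rw [le_div_iff₀ hab]; linarith
  have hq2 : c / (a * b) ≤ 1 := by rw [div_le_iff₀ hab]; linarith
  have hθ0 : 0 ≤ θ := by linarith
  have hθ1 : θ ≤ 1 := by linarith
  have hmix : (1 - θ) * (a - b) ^ 2 + θ * (a + b) ^ 2 = a ^ 2 + b ^ 2 + 2 * c := by
    rw [hθ]; field_simp; ring
  have hn : ‖s + x‖ ^ 2 ≤ (1 - θ) * (a - b) ^ 2 + θ * (a + b) ^ 2 := by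
    rw [hmix, norm_add_sq_real]
    have : ‖x‖ ^ 2 ≤ b ^ 2 := by gcongr
    linarith
  calc Real.cosh ‖s + x‖ ≤ Real.cosh √((1 - θ) * (a - b) ^ 2 + θ * (a + b) ^ 2) := by
        rw [Real.cosh_le_cosh, abs_of_nonneg (norm_nonneg _), abs_of_nonneg (Real.sqrt_nonneg _)]
        exact Real.le_sqrt_of_sq_le hn
    _ ≤ (1 - θ) * Real.cosh (a - b) + θ * Real.cosh (a + b) := cosh_sqrt_le hθ0 hθ1 _ _
    _ = _ := by
        rw [Real.cosh_sub, Real.cosh_add, hθ]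
        field_simp
        ring

variable [CompleteSpace H] [MeasurableSpace H] [BorelSpace H] [SecondCountableTopology H]

lemma lintegral_cosh_norm_add_le {μ : Measure H} [IsProbabilityMeasure μ] {b : ℝ}
    (hb : ∀ᵐ x ∂μ, ‖x‖ ≤ b) (h0 : ∫ x, x ∂μ = 0) (s : H) :
    ∫⁻ x, ENNReal.ofReal (Real.cosh ‖s + x‖) ∂μ ≤
      ENNReal.ofReal (Real.cosh ‖s‖) * ENNReal.ofReal (Real.cosh b) := by
  have hi : Integrable (fun x : H => x) μ :=
    Integrable.of_bound (by fun_prop) b hb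
  set κ := Real.sinh ‖s‖ * Real.sinh b / (‖s‖ * b) with hκ
  have hle : ∀ᵐ x ∂μ, Real.cosh ‖s + x‖ ≤
      Real.cosh ‖s‖ * Real.cosh b + κ * inner ℝ s x := hb.mono fun x hx => cosh_norm_add_le hx
  have hint : Integrable (fun x => Real.cosh ‖s‖ * Real.cosh b + κ * inner ℝ s x) μ :=
    (integrable_const _).add ((hi.const_inner s).const_mul κ)
  calc _ ≤ ∫⁻ x, ENNReal.ofReal (Real.cosh ‖s‖ * Real.cosh b + κ * inner ℝ s x) ∂μ :=
        lintegral_mono_ae (hle.mono fun x hx => ENNReal.ofReal_le_ofReal hx)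
    _ = ENNReal.ofReal (∫ x, (Real.cosh ‖s‖ * Real.cosh b + κ * inner ℝ s x) ∂μ) :=
        (ofReal_integral_eq_lintegral_ofReal hint
          (hle.mono fun x hx => (Real.cosh_pos _).le.trans hx)).symm
    _ = _ := by
        rw [integral_add (integrable_const _) ((hi.const_inner s).const_mul κ),
          integral_const_mul κ, integral_inner hi, h0]
        simp [ENNReal.ofReal_mul (Real.cosh_pos _).le]

variable {Ω : Type*} [MeasurableSpace Ω] {P : Measure Ω} [IsProbabilityMeasure P]
  {κ : Type*} {Y : κ → Ω → H}

/-- Each further vector is independent of the previous sum, so integrating it out first costs one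
factor cosh b. -/
lemma lintegral_cosh_norm_sum_le (hY : ∀ k, AEMeasurable (Y k) P) (hind : iIndepFun Y P) {b : ℝ}
    (hb : ∀ k, ∀ᵐ ω ∂P, ‖Y k ω‖ ≤ b) (h0 : ∀ k, ∫ ω, Y k ω ∂P = 0) (T : Finset κ) :
    ∫⁻ ω, ENNReal.ofReal (Real.cosh ‖∑ k ∈ T, Y k ω‖) ∂P ≤
      ENNReal.ofReal (Real.cosh b) ^ T.card := by
  classical
  have hφ : Measurable fun x : H => ENNReal.ofReal (Real.cosh ‖x‖) := by fun_prop
  induction T using Finset.induction_on with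
  | empty => simp
  | insert k T hk ih =>
    have hS : AEMeasurable (∑ j ∈ T, Y j) P := Finset.aemeasurable_sum T fun j _ => hY j
    have hi : IndepFun (∑ j ∈ T, Y j) (Y k) P := hind.indepFun_finsetSum_of_notMem₀ hY hk
    have hmap := (indepFun_iff_map_prod_eq_prod_map_map hS (hY k)).1 hi
    have : IsProbabilityMeasure (P.map (Y k)) := Measure.isProbabilityMeasure_map (hY k)
    have : IsProbabilityMeasure (P.map (∑ j ∈ T, Y j)) := Measure.isProbabilityMeasure_map hS
    have hφ2 : Measurable fun q : H × H => ENNReal.ofReal (Real.cosh ‖q.1 + q.2‖) := by fun_prop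
    have hbk : ∀ᵐ x ∂(P.map (Y k)), ‖x‖ ≤ b :=
      (ae_map_iff (hY k) (measurableSet_le measurable_norm measurable_const)).2 (hb k)
    have h0k : ∫ x, x ∂(P.map (Y k)) = 0 := by
      rw [integral_map (hY k) (by fun_prop)]
      exact h0 k
    calc ∫⁻ ω, ENNReal.ofReal (Real.cosh ‖∑ j ∈ insert k T, Y j ω‖) ∂P
        = ∫⁻ ω, ENNReal.ofReal (Real.cosh ‖(∑ j ∈ T, Y j) ω + Y k ω‖) ∂P := by
          refine lintegral_congr fun ω => ?_
          rw [Finset.sum_insert hk, Finset.sum_apply, add_comm]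
      _ = ∫⁻ q, ENNReal.ofReal (Real.cosh ‖q.1 + q.2‖)
            ∂(P.map fun ω => ((∑ j ∈ T, Y j) ω, Y k ω)) :=
          (lintegral_map' hφ2.aemeasurable (hS.prodMk (hY k))).symm
      _ = ∫⁻ s, ∫⁻ x, ENNReal.ofReal (Real.cosh ‖s + x‖) ∂(P.map (Y k))
            ∂(P.map (∑ j ∈ T, Y j)) := by
          rw [hmap, lintegral_prod _ hφ2.aemeasurable]
      _ ≤ ∫⁻ s, ENNReal.ofReal (Real.cosh ‖s‖) * ENNReal.ofReal (Real.cosh b)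
            ∂(P.map (∑ j ∈ T, Y j)) :=
          lintegral_mono fun s => lintegral_cosh_norm_add_le hbk h0k s
      _ = (∫⁻ ω, ENNReal.ofReal (Real.cosh ‖∑ j ∈ T, Y j ω‖) ∂P) *
            ENNReal.ofReal (Real.cosh b) := by
          rw [lintegral_mul_const _ hφ, lintegral_map' hφ.aemeasurable hS]
          simp only [Finset.sum_apply]
      _ ≤ _ := by
          rw [Finset.card_insert_of_notMem hk, pow_succ]
          gcongr

/-- Markov's inequality for cosh of the norm, with cosh b ≤ e^{b²/2} and cosh t ≥ e^t/2; the last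
bound is the source of the factor 2. -/
lemma measure_norm_sum_ge_le_exp [Fintype κ] (hY : ∀ k, AEMeasurable (Y k) P)
    (hind : iIndepFun Y P) {b : ℝ} (hb : ∀ k, ∀ᵐ ω ∂P, ‖Y k ω‖ ≤ b)
    (h0 : ∀ k, ∫ ω, Y k ω ∂P = 0) {t : ℝ} (ht : 0 ≤ t) :
    P.real {ω | t ≤ ‖∑ k, Y k ω‖} ≤ 2 * Real.exp (Fintype.card κ * b ^ 2 / 2 - t) := by
  have h1 := lintegral_cosh_norm_sum_le hY hind hb h0 Finset.univ
  have hm : AEMeasurable (fun ω => ENNReal.ofReal (Real.cosh ‖∑ k, Y k ω‖)) P := by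
    have : AEMeasurable (fun ω => ∑ k, Y k ω) P := Finset.aemeasurable_fun_sum _ fun k _ => hY k
    fun_prop
  have h2 := (mul_meas_ge_le_lintegral₀ hm (ENNReal.ofReal (Real.cosh t))).trans h1
  have h3 : {ω | t ≤ ‖∑ k, Y k ω‖} ⊆
      {ω | ENNReal.ofReal (Real.cosh t) ≤ ENNReal.ofReal (Real.cosh ‖∑ k, Y k ω‖)} := fun ω hω =>
    ENNReal.ofReal_le_ofReal (Real.cosh_le_cosh.2 (by
      rw [abs_of_nonneg ht, abs_of_nonneg (norm_nonneg _)]; exact hω))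
  have h4 := (mul_le_mul_right (measure_mono h3) _).trans h2
  rw [← ENNReal.ofReal_pow (Real.cosh_pos _).le, ← ofReal_measureReal,
    ← ENNReal.ofReal_mul (Real.cosh_pos _).le,
    ENNReal.ofReal_le_ofReal_iff (pow_nonneg (Real.cosh_pos _).le _)] at h4
  have h5 : Real.cosh b ^ (Finset.univ : Finset κ).card ≤ Real.exp (Fintype.card κ * b ^ 2 / 2) := by
    calc _ ≤ Real.exp (b ^ 2 / 2) ^ (Finset.univ : Finset κ).card :=
          pow_le_pow_left₀ (Real.cosh_pos _).le (Real.cosh_le_exp_half_sq b) _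
      _ = _ := by rw [← Real.exp_nat_mul, Finset.card_univ]; ring_nf
  have h6 : Real.exp t / 2 ≤ Real.cosh t := by
    rw [Real.cosh_eq]
    have := Real.exp_pos (-t)
    linarith
  have h7 : Real.exp t / 2 * P.real {ω | t ≤ ‖∑ k, Y k ω‖} ≤
      Real.exp (Fintype.card κ * b ^ 2 / 2) :=
    (mul_le_mul_of_nonneg_right h6 measureReal_nonneg).trans (h4.trans h5)
  rw [Real.exp_sub, mul_div_assoc', le_div_iff₀ (Real.exp_pos t)]
  linarith

/-- Hoeffding's inequality for sums of independent centred bounded vectors in a Hilbert space. -/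
theorem measure_norm_sum_ge_le [Fintype κ] [Nonempty κ] (hY : ∀ k, AEMeasurable (Y k) P)
    (hind : iIndepFun Y P) {b : ℝ} (hb0 : 0 < b) (hb : ∀ k, ∀ᵐ ω ∂P, ‖Y k ω‖ ≤ b)
    (h0 : ∀ k, ∫ ω, Y k ω ∂P = 0) {t : ℝ} (ht : 0 ≤ t) :
    P.real {ω | t ≤ ‖∑ k, Y k ω‖} ≤ 2 * Real.exp (-(t ^ 2 / (2 * Fintype.card κ * b ^ 2))) := by
  rcases ht.eq_or_lt with rfl | ht
  · refine measureReal_le_one.trans ?_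
    norm_num
  have hN : (0 : ℝ) < Fintype.card κ := by exact_mod_cast Fintype.card_pos
  -- The minimiser of N(lb)²/2 - lt, the exponent obtained after scaling all vectors by l.
  set l := t / (Fintype.card κ * b ^ 2) with hl
  have hl0 : 0 < l := by positivity
  have h := measure_norm_sum_ge_le_exp (Y := fun k ω => l • Y k ω) (P := P)
    (fun k => (hY k).const_smul l)
    (hind.comp (fun _ x => l • x) fun _ => measurable_const_smul l) (b := l * b)
    (fun k => (hb k).mono fun ω hω => by
      rw [norm_smul, Real.norm_of_nonneg hl0.le]; gcongr)
    (fun k => by rw [integral_smul, h0 k, smul_zero]) (t := l * t) (by positivity)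
  have e1 : {ω | l * t ≤ ‖∑ k, l • Y k ω‖} = {ω | t ≤ ‖∑ k, Y k ω‖} := by
    ext ω
    simp only [Set.mem_ofPred_eq]
    rw [← Finset.smul_sum, norm_smul, Real.norm_of_nonneg hl0.le, mul_le_mul_iff_right₀ hl0]
  rw [e1] at h
  refine h.trans_eq ?_
  congr 2
  rw [hl]
  field_simp
  ring

end Hilbert

section Main

variable {d n : ℕ}

/-! ### Concentration of empirical moment matrices -/

lemma support_subset {K : Set (Cn d)} (hK : IsCompact K) {μ : Measure (Cn d)} (hμ : μ Kᶜ = 0) :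
    μ.support ⊆ K :=
  Measure.support_subset_of_isClosed hK.isClosed (mem_ae_iff.2 hμ)

lemma one_le_coordBound (μ : Measure (Cn d)) : 1 ≤ coordBound μ := le_max_left _ _

lemma ae_norm_le_coordBound {K : Set (Cn d)} (hK : IsCompact K) {μ : Measure (Cn d)}
    (hμ : μ Kᶜ = 0) : ∀ᵐ x ∂μ, ‖(WithLp.ofLp x : Fin d → ℂ)‖ ≤ coordBound μ := by
  have hc : Continuous fun x : Cn d => ‖(WithLp.ofLp x : Fin d → ℂ)‖ := by fun_prop
  filter_upwards [Measure.support_mem_ae (μ := μ)] with x hx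
  refine le_max_of_le_right (le_csSup ?_ ⟨x, hx, rfl⟩)
  exact (hK.bddAbove_image hc.continuousOn).mono (Set.image_mono (support_subset hK hμ))

lemma norm_monomial_le (x : Cn d) (α : Fin d → ℕ) :
    ‖monomial x α‖ ≤ ‖(WithLp.ofLp x : Fin d → ℂ)‖ ^ (∑ i, α i) := by
  rw [monomial, norm_prod, ← Finset.prod_pow_eq_pow_sum]
  refine Finset.prod_le_prod (fun _ _ => norm_nonneg _) fun i _ => ?_
  rw [norm_pow]
  have := norm_le_pi_norm (WithLp.ofLp x : Fin d → ℂ) i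
  gcongr

lemma norm_conj_monomial_mul_le (x : Cn d) (q : MultiIndex d n × MultiIndex d n) :
    ‖conj (monomial x q.1.1) * monomial x q.2.1‖ ≤
      ‖(WithLp.ofLp x : Fin d → ℂ)‖ ^ (∑ i, q.1.1 i + ∑ i, q.2.1 i) := by
  rw [norm_mul, RCLike.norm_conj, pow_add]
  exact mul_le_mul (norm_monomial_le x _) (norm_monomial_le x _) (norm_nonneg _) (by positivity)

/-- The matrix `(conj(x)^α x^β)`, as a vector. -/
def momentVec (n : ℕ) (x : Cn d) : EuclideanSpace ℂ (MultiIndex d n × MultiIndex d n) :=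
  WithLp.toLp 2 fun q => conj (monomial x q.1.1) * monomial x q.2.1

/-- The moment matrix, as a vector. -/
def momentMatrixVec (n : ℕ) (μ : Measure (Cn d)) :
    EuclideanSpace ℂ (MultiIndex d n × MultiIndex d n) :=
  WithLp.toLp 2 fun q => momentMatrix n μ q.1 q.2

lemma continuous_momentVec (n : ℕ) : Continuous (momentVec (d := d) n) := by
  refine (PiLp.continuous_toLp 2 _).comp (continuous_pi fun q => ?_)
  exact (Complex.continuous_conj.comp (continuous_monomial q.1.1)).mul (continuous_monomial q.2.1)

variable {K : Set (Cn d)} {μ : Measure (Cn d)}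

lemma integral_momentVec [IsFiniteMeasure μ] (hK : IsCompact K) (hμ : μ Kᶜ = 0) :
    ∫ x, momentVec n x ∂μ = momentMatrixVec n μ := by
  have hi : Integrable (momentVec (d := d) n) μ :=
    integrable_of_continuous hK hμ (continuous_momentVec n)
  ext q
  exact ((EuclideanSpace.proj q : EuclideanSpace ℂ (MultiIndex d n × MultiIndex d n) →L[ℂ] ℂ).integral_comp_comm
    hi).symm

/-- The mean of `max_i |x_i|`, relative to the largest value `L_μ`. -/
def relativeMean (μ : Measure (Cn d)) : ℝ :=
  (∫ x, ‖(WithLp.ofLp x : Fin d → ℂ)‖ ∂μ) / coordBound μ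

lemma relativeMean_nonneg (μ : Measure (Cn d)) : 0 ≤ relativeMean μ :=
  div_nonneg (integral_nonneg fun _ => norm_nonneg _) (zero_le_one.trans (one_le_coordBound μ))

lemma norm_momentMatrix_le [IsProbabilityMeasure μ] (hK : IsCompact K) (hμ : μ Kᶜ = 0)
    (q : MultiIndex d n × MultiIndex d n) :
    ‖momentMatrix n μ q.1 q.2‖ ≤ coordBound μ ^ (2 * n) := by
  have h := norm_integral_le_of_norm_le_const (μ := μ)
    (f := fun x => conj (monomial x q.1.1) * monomial x q.2.1) (C := coordBound μ ^ (2 * n))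
    ((ae_norm_le_coordBound hK hμ).mono fun x hx => (norm_conj_monomial_mul_le x q).trans
      ((pow_le_pow_left₀ (norm_nonneg _) hx _).trans
        (pow_le_pow_right₀ (one_le_coordBound μ) (by have := q.1.2; have := q.2.2; omega))))
  simpa [momentMatrix] using h

/-- In positive degree one power of max |x_i| is integrated instead of being bounded by L. Every
entry except (0,0) gains the factor σ = `relativeMean μ`. -/
lemma norm_momentMatrix_le_relativeMean [IsProbabilityMeasure μ] (hK : IsCompact K)
    (hμ : μ Kᶜ = 0) {q : MultiIndex d n × MultiIndex d n}
    (hq : ∑ i, q.1.1 i + ∑ i, q.2.1 i ≠ 0) :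
    ‖momentMatrix n μ q.1 q.2‖ ≤ coordBound μ ^ (2 * n) * relativeMean μ := by
  set L := coordBound μ with hL
  have hL1 : 1 ≤ L := one_le_coordBound μ
  have hL0 : 0 < L := one_pos.trans_le hL1
  have hc : Continuous fun x : Cn d => ‖(WithLp.ofLp x : Fin d → ℂ)‖ := by fun_prop
  have hb : ∀ᵐ x ∂μ, ‖conj (monomial x q.1.1) * monomial x q.2.1‖ ≤
      L ^ (2 * n) * (‖(WithLp.ofLp x : Fin d → ℂ)‖ / L) := by
    filter_upwards [ae_norm_le_coordBound hK hμ] with x hx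
    obtain ⟨k, hk⟩ := Nat.exists_eq_succ_of_ne_zero hq
    refine (norm_conj_monomial_mul_le x q).trans ?_
    have hkn : k + 1 ≤ 2 * n := by have := q.1.2; have := q.2.2; omega
    rw [hk, Nat.succ_eq_add_one, pow_succ]
    calc _ ≤ L ^ k * ‖(WithLp.ofLp x : Fin d → ℂ)‖ := by gcongr
      _ = L ^ (k + 1) * (‖(WithLp.ofLp x : Fin d → ℂ)‖ / L) := by field_simp; ring
      _ ≤ _ := by gcongr
  have hi : Integrable (fun x : Cn d => L ^ (2 * n) * (‖(WithLp.ofLp x : Fin d → ℂ)‖ / L)) μ :=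
    integrable_of_continuous hK hμ (by fun_prop)
  refine (norm_integral_le_of_norm_le hi hb).trans_eq ?_
  rw [integral_const_mul, integral_div, relativeMean]

lemma eq_zero_of_sum_eq_zero {q : MultiIndex d n × MultiIndex d n}
    (hq : ∑ i, q.1.1 i + ∑ i, q.2.1 i = 0) : q.1.1 = 0 ∧ q.2.1 = 0 := by
  obtain ⟨h1, h2⟩ := Nat.add_eq_zero_iff.1 hq
  exact ⟨funext fun i => Finset.sum_eq_zero_iff.1 h1 i (Finset.mem_univ i),
    funext fun i => Finset.sum_eq_zero_iff.1 h2 i (Finset.mem_univ i)⟩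

lemma sum_norm_momentMatrix_sq_le [IsProbabilityMeasure μ] (hK : IsCompact K) (hμ : μ Kᶜ = 0) :
    ∑ q : MultiIndex d n × MultiIndex d n, ‖momentMatrix n μ q.1 q.2‖ ^ 2 ≤
      coordBound μ ^ (4 * n) *
        (1 + ((Fintype.card (MultiIndex d n) : ℝ) ^ 2 - 1) * relativeMean μ ^ 2) := by
  classical
  let q₀ : MultiIndex d n × MultiIndex d n := (⟨0, by simp⟩, ⟨0, by simp⟩)
  have hpow : (coordBound μ ^ (2 * n)) ^ 2 = coordBound μ ^ (4 * n) := by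
    rw [← pow_mul]; congr 1; ring
  rw [← Finset.add_sum_erase _ _ (Finset.mem_univ q₀)]
  have h1 : ‖momentMatrix n μ q₀.1 q₀.2‖ ^ 2 ≤ coordBound μ ^ (4 * n) := by
    rw [← hpow]
    have := norm_momentMatrix_le hK hμ q₀
    gcongr
  have h2 : ∀ q ∈ Finset.univ.erase q₀, ‖momentMatrix n μ q.1 q.2‖ ^ 2 ≤
      coordBound μ ^ (4 * n) * relativeMean μ ^ 2 := fun q hq => by
    have hq' : ∑ i, q.1.1 i + ∑ i, q.2.1 i ≠ 0 := fun h => by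
      obtain ⟨e1, e2⟩ := eq_zero_of_sum_eq_zero h
      exact (Finset.mem_erase.1 hq).1 (Prod.ext (Subtype.ext e1) (Subtype.ext e2))
    have := norm_momentMatrix_le_relativeMean hK hμ hq'
    rw [← hpow, ← mul_pow]
    gcongr
  have h3 := Finset.sum_le_sum h2
  rw [Finset.sum_const, Finset.card_erase_of_mem (Finset.mem_univ _), Finset.card_univ,
    Fintype.card_prod, nsmul_eq_mul, Nat.cast_sub (Nat.one_le_iff_ne_zero.2 (by positivity))] at h3
  push_cast at h3
  linarith [h1, h3]

lemma sum_norm_moments_sq_le {x : Cn d} {L : ℝ} (hL : 1 ≤ L)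
    (hx : ‖(WithLp.ofLp x : Fin d → ℂ)‖ ≤ L) :
    ∑ q : MultiIndex d n × MultiIndex d n, ‖conj (monomial x q.1.1) * monomial x q.2.1‖ ^ 2 ≤
      (Fintype.card (MultiIndex d n) : ℝ) ^ 2 * L ^ (4 * n) := by
  have h : ∀ q ∈ (Finset.univ : Finset (MultiIndex d n × MultiIndex d n)),
      ‖conj (monomial x q.1.1) * monomial x q.2.1‖ ^ 2 ≤ L ^ (4 * n) := fun q _ => by
    have h1 : ‖conj (monomial x q.1.1) * monomial x q.2.1‖ ≤ L ^ (2 * n) :=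
      (norm_conj_monomial_mul_le x q).trans ((pow_le_pow_left₀ (norm_nonneg _) hx _).trans
        (pow_le_pow_right₀ hL (by have := q.1.2; have := q.2.2; omega)))
    calc _ ≤ (L ^ (2 * n)) ^ 2 := by gcongr
      _ = _ := by rw [← pow_mul]; congr 1; ring
  have h2 := Finset.sum_le_sum h
  rw [Finset.sum_const, Finset.card_univ, Fintype.card_prod, nsmul_eq_mul] at h2
  push_cast at h2
  linarith

lemma norm_sub_sq_complex (a b : ℂ) : ‖a - b‖ ^ 2 = ‖a‖ ^ 2 + ‖b‖ ^ 2 - 2 * (b * conj a).re := by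
  have := norm_sub_sq (𝕜 := ℂ) a b
  simp only [RCLike.inner_apply, RCLike.re_to_complex] at this
  linarith

/-- In the expanded square the cross term is -2 times the value of the positive form D at the vector
conj(x^α), so it can be dropped. The two squares are at most R²L^{4n} and L^{4n}(1 + (R² - 1)σ²),
and for R ≥ 2 the latter is at most (1/4 + 3σ²/4)R²L^{4n}. For R = 1 only the constant monomial is
left and the difference is 0. -/
lemma norm_momentVec_sub_sq_le [IsProbabilityMeasure μ] (hK : IsCompact K) (hμ : μ Kᶜ = 0)
    (hσ : relativeMean μ < 1) {x : Cn d} (hx : ‖(WithLp.ofLp x : Fin d → ℂ)‖ ≤ coordBound μ) :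
    ‖momentVec n x - momentMatrixVec n μ‖ ^ 2 ≤ (5 / 4 + 3 / 4 * relativeMean μ ^ 2) *
      ((Fintype.card (MultiIndex d n) : ℝ) ^ 2 * coordBound μ ^ (4 * n)) := by
  set L := coordBound μ with hL
  have hL1 : 1 ≤ L := one_le_coordBound μ
  set R : ℝ := (Fintype.card (MultiIndex d n) : ℝ) with hR
  set σ := relativeMean μ with hσD
  have hσ0 : 0 ≤ σ := relativeMean_nonneg μ
  have hLp : 0 < L ^ (4 * n) := pow_pos (one_pos.trans_le hL1) _
  have hnorm : ‖momentVec n x - momentMatrixVec n μ‖ ^ 2 =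
      ∑ q : MultiIndex d n × MultiIndex d n,
        ‖conj (monomial x q.1.1) * monomial x q.2.1 - momentMatrix n μ q.1 q.2‖ ^ 2 := by
    rw [EuclideanSpace.norm_sq_eq]
    rfl
  rw [hnorm]
  have hcard : 1 ≤ Fintype.card (MultiIndex d n) := Fintype.card_pos
  rcases hcard.eq_or_lt with h1 | h2
  · have hs : Subsingleton (MultiIndex d n) := Fintype.card_le_one_iff_subsingleton.1 h1.symm.le
    refine (Finset.sum_eq_zero fun q _ => ?_).trans_le (by positivity)
    have e1 : q.1.1 = 0 := congrArg Subtype.val (Subsingleton.elim q.1 ⟨0, by simp⟩)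
    have e2 : q.2.1 = 0 := congrArg Subtype.val (Subsingleton.elim q.2 ⟨0, by simp⟩)
    simp [momentMatrix, e1, e2, monomial]
  · have hR2 : 2 ≤ R := by rw [hR]; exact_mod_cast h2
    have hcross : 0 ≤ (∑ q : MultiIndex d n × MultiIndex d n, momentMatrix n μ q.1 q.2 *
        conj (conj (monomial x q.1.1) * monomial x q.2.1)).re := by
      have h := quadForm_momentMatrix hK hμ (fun α : MultiIndex d n => conj (monomial x α.1))
      have h0 : 0 ≤ quadForm (momentMatrix n μ) fun α => conj (monomial x α.1) := by
        rw [h]; exact integral_nonneg fun _ => by positivity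
      rw [quadForm_eq_sum] at h0
      convert h0 using 3
      rw [map_mul]
    simp only [norm_sub_sq_complex]
    rw [Finset.sum_sub_distrib, Finset.sum_add_distrib, ← Finset.mul_sum, ← Complex.re_sum]
    have b1 := sum_norm_moments_sq_le (n := n) hL1 hx
    have b2 := sum_norm_momentMatrix_sq_le (n := n) hK hμ
    rw [← hL, ← hR, ← hσD] at b2
    rw [← hR] at b1
    have b3 : 1 + (R ^ 2 - 1) * σ ^ 2 ≤ (1 / 4 + 3 / 4 * σ ^ 2) * R ^ 2 := by
      nlinarith [mul_nonneg (sub_nonneg.2 (by nlinarith : (4 : ℝ) ≤ R ^ 2))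
        (sub_nonneg.2 (by nlinarith : σ ^ 2 ≤ 1))]
    have b4 := mul_le_mul_of_nonneg_left b3 hLp.le
    nlinarith

/-- The stability constant `1 - √((5/4 + 3σ²/4)/2)`, where `σ` is the relative mean. -/
def stabilityConst (μ : Measure (Cn d)) : ℝ := 1 - √((5 / 4 + 3 / 4 * relativeMean μ ^ 2) / 2)

lemma stabilityConst_le_one (μ : Measure (Cn d)) : stabilityConst μ ≤ 1 :=
  sub_le_self _ (Real.sqrt_nonneg _)

lemma stabilityConst_pos (hσ : relativeMean μ < 1) : 0 < stabilityConst μ := by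
  have h0 := relativeMean_nonneg μ
  rw [stabilityConst, sub_pos, Real.sqrt_lt' one_pos]
  nlinarith

lemma momentVec_average {N : ℕ} (z : Fin N → Cn d) (hN : N ≠ 0) :
    ∑ q : MultiIndex d n × MultiIndex d n,
      ‖(momentMatrix n (empiricalMeasure z) - momentMatrix n μ) q.1 q.2‖ ^ 2 =
      ((N : ℝ)⁻¹ * ‖∑ k, (momentVec n (z k) - momentMatrixVec n μ)‖) ^ 2 := by
  have hN' : (N : ℂ) ≠ 0 := by exact_mod_cast hN
  rw [mul_pow, EuclideanSpace.norm_sq_eq, Finset.mul_sum]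
  refine Finset.sum_congr rfl fun q _ => ?_
  have : (momentMatrix n (empiricalMeasure z) - momentMatrix n μ) q.1 q.2 =
      (N : ℂ)⁻¹ * (∑ k, (momentVec n (z k) - momentMatrixVec n μ)) q := by
    rw [Matrix.sub_apply, momentMatrix_empirical, Finset.sum_sub_distrib]
    simp [momentVec, momentMatrixVec, Finset.sum_apply, mul_sub, hN']
  rw [this, norm_mul, mul_pow]
  simp

/-- Hoeffding with b² = κR²L^{4n} and t = N√(κ/2)Λ: the factor κ cancels in t²/(2Nb²) =
NΛ²/(4R²L^{4n}), which the sample size makes at least log(2/δ). Off the exceptional event the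
Frobenius deviation is at most √(κ/2)Λ, and κ < 2 leaves a positive fraction of Λ. -/
theorem measure_isStableSample [IsProbabilityMeasure μ] (hK : IsCompact K) (hμ : μ Kᶜ = 0)
    (hσ : relativeMean μ < 1) (hΛ : 0 < smallestEigenvalue n μ) {N : ℕ} {δ : ℝ} (hδ : 0 < δ)
    (hδ1 : δ < 1)
    (hN : coordBound μ ^ (4 * n) * (Fintype.card (MultiIndex d n) : ℝ) ^ 2 /
      smallestEigenvalue n μ ^ 2 * (4 * Real.log (2 / δ)) ≤ (N : ℝ))
    {Ω : Type*} [MeasurableSpace Ω] {P : Measure Ω} [IsProbabilityMeasure P]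
    {x : Fin N → Ω → Cn d} (hind : iIndepFun x P) (hx : ∀ k, HasLaw (x k) μ P) :
    P.real {ω | ¬ IsStableSample n (fun k => x k ω)
      (stabilityConst μ * smallestEigenvalue n μ)} ≤ δ := by
  set L := coordBound μ with hL
  set Λ := smallestEigenvalue n μ with hΛD
  set R : ℝ := (Fintype.card (MultiIndex d n) : ℝ) with hR
  set κ := 5 / 4 + 3 / 4 * relativeMean μ ^ 2 with hκ
  have hκ0 : 0 < κ := by positivity
  have hR0 : 0 < R := by rw [hR]; exact_mod_cast Fintype.card_pos
  have hL0 : 0 < L := one_pos.trans_le (one_le_coordBound μ)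
  have hlog : 0 < Real.log (2 / δ) := Real.log_pos (by rw [lt_div_iff₀ hδ]; linarith)
  have hNpos : (0 : ℝ) < N := lt_of_lt_of_le (by positivity) hN
  have hN0 : N ≠ 0 := by exact_mod_cast hNpos.ne'
  have : Nonempty (Fin N) := ⟨⟨0, Nat.pos_of_ne_zero hN0⟩⟩
  let G : Cn d → EuclideanSpace ℂ (MultiIndex d n × MultiIndex d n) := fun x =>
    momentVec n x - momentMatrixVec n μ
  have hG : Continuous G := (continuous_momentVec n).sub continuous_const
  set b := √(κ * (R ^ 2 * L ^ (4 * n))) with hb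
  have hb0 : 0 < b := Real.sqrt_pos.2 (by positivity)
  have hGb : ∀ k, ∀ᵐ ω ∂P, ‖G (x k ω)‖ ≤ b := fun k => by
    have h1 : ∀ᵐ y ∂(P.map (x k)), ‖(WithLp.ofLp y : Fin d → ℂ)‖ ≤ L := by
      rw [(hx k).map_eq]; exact ae_norm_le_coordBound hK hμ
    filter_upwards [ae_of_ae_map (hx k).aemeasurable h1] with ω hω
    exact Real.le_sqrt_of_sq_le (norm_momentVec_sub_sq_le hK hμ hσ hω)
  have hG0 : ∀ k, ∫ ω, G (x k ω) ∂P = 0 := fun k => by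
    rw [← integral_map (hx k).aemeasurable hG.aestronglyMeasurable, (hx k).map_eq,
      integral_sub (integrable_of_continuous hK hμ (continuous_momentVec n)) (integrable_const _),
      integral_momentVec hK hμ]
    simp
  set t := N * ((1 - stabilityConst μ) * Λ) with ht
  have hs : 1 - stabilityConst μ = √(κ / 2) := by rw [stabilityConst]; ring
  have ht0 : 0 ≤ t := by rw [ht, hs]; positivity
  have h := measure_norm_sum_ge_le (Y := fun k ω => G (x k ω)) (P := P)
    (fun k => hG.measurable.comp_aemeasurable (hx k).aemeasurable)
    (hind.comp (fun _ => G) fun _ => hG.measurable) hb0 hGb hG0 ht0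
  have hexp : Real.log (2 / δ) ≤ t ^ 2 / (2 * Fintype.card (Fin N) * b ^ 2) := by
    have e1 : t ^ 2 / (2 * Fintype.card (Fin N) * b ^ 2) = N * Λ ^ 2 / (4 * (R ^ 2 * L ^ (4 * n))) := by
      rw [ht, hs, hb, Real.sq_sqrt (by positivity), Fintype.card_fin, mul_pow, mul_pow,
        Real.sq_sqrt (by positivity)]
      field_simp
      ring
    rw [e1, le_div_iff₀ (by positivity)]
    rw [div_mul_eq_mul_div, div_le_iff₀ (by positivity)] at hN
    linarith
  have hfin : 2 * Real.exp (-(t ^ 2 / (2 * Fintype.card (Fin N) * b ^ 2))) ≤ δ := by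
    calc _ ≤ 2 * Real.exp (-Real.log (2 / δ)) := by gcongr
      _ = δ := by
        rw [Real.exp_neg, Real.exp_log (by positivity)]
        field_simp
  refine (measureReal_mono fun ω hω => ?_).trans (h.trans hfin)
  by_contra hlt
  refine hω (isStableSample_of_frobenius (stabilityConst_le_one μ) hΛ.le ?_)
  rw [momentVec_average _ hN0]
  have hlt' : ‖∑ k, G (x k ω)‖ ≤ t := (not_le.1 hlt).le
  have : (N : ℝ)⁻¹ * ‖∑ k, G (x k ω)‖ ≤ (1 - stabilityConst μ) * Λ := by
    rw [inv_mul_le_iff₀ hNpos]; exact hlt'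
  gcongr

/-- Equality would force max |x_i| = L almost surely, but spheres of the maximum norm of positive
radius are Lebesgue null in ℝ^d. -/
lemma relativeMean_lt_one {ν : Measure (EuclideanSpace ℝ (Fin d))} [IsProbabilityMeasure ν]
    (hν : ν ≪ volume) (hK : IsCompact K) (hνK : (ν.map ofRealVec) Kᶜ = 0) :
    relativeMean (ν.map ofRealVec) < 1 := by
  have hm : Measurable (ofRealVec (d := d)) := continuous_ofRealVec.measurable
  set μ := ν.map (ofRealVec (d := d)) with hμ
  have : IsProbabilityMeasure μ := Measure.isProbabilityMeasure_map hm.aemeasurable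
  set L := coordBound μ with hL
  have hL0 : 0 < L := one_pos.trans_le (one_le_coordBound μ)
  have hc : Continuous fun x : Cn d => ‖(WithLp.ofLp x : Fin d → ℂ)‖ := by fun_prop
  have hi := integrable_of_continuous hK hνK hc
  have hle := ae_norm_le_coordBound hK hνK
  rw [relativeMean, div_lt_one hL0]
  have hnn : 0 ≤ᵐ[μ] fun x => L - ‖(WithLp.ofLp x : Fin d → ℂ)‖ :=
    hle.mono fun x hx => sub_nonneg.2 hx
  have hint : ∫ x, (L - ‖(WithLp.ofLp x : Fin d → ℂ)‖) ∂μ =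
      L - ∫ x, ‖(WithLp.ofLp x : Fin d → ℂ)‖ ∂μ := by
    rw [integral_sub (integrable_const _) hi]
    simp
  have hpos := integral_nonneg_of_ae hnn
  rcases hpos.eq_or_lt with h0 | h0
  · exfalso
    have h1 := (integral_eq_zero_iff_of_nonneg_ae hnn ((integrable_const L).sub hi)).1 h0.symm
    have h2 := ae_of_ae_map hm.aemeasurable h1
    have hs : volume (Metric.sphere (0 : Fin d → ℝ) L) = 0 :=
      Measure.addHaar_sphere_of_ne_zero volume 0 hL0.ne'
    have hs' : ν {x | (WithLp.ofLp x : Fin d → ℝ) ∈ Metric.sphere (0 : Fin d → ℝ) L} = 0 :=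
      hν ((PiLp.volume_preserving_ofLp (Fin d)).quasiMeasurePreserving.preimage_null hs)
    have h3 : ∀ᵐ x ∂ν, (WithLp.ofLp x : Fin d → ℝ) ∉ Metric.sphere (0 : Fin d → ℝ) L := by
      rw [ae_iff]
      simpa using hs'
    obtain ⟨x, hx1, hx2⟩ := (h2.and h3).exists
    apply hx2
    have e : ‖(WithLp.ofLp (ofRealVec x) : Fin d → ℂ)‖ = ‖(WithLp.ofLp x : Fin d → ℝ)‖ := by
      simp [ofRealVec, Pi.norm_def]
    have hx1' : L - ‖(WithLp.ofLp (ofRealVec x) : Fin d → ℂ)‖ = 0 := hx1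
    rw [mem_sphere_zero_iff_norm, ← e]
    linarith
  · linarith

/-! ### Weak convergence of empirical measures -/

lemma tendsto_average [IsFiniteMeasure μ] (hK : IsCompact K) (hμ : μ Kᶜ = 0) {z : ℕ → Cn d}
    (hz : ∀ k, z k ∈ K)
    (hw : ∀ φ : BoundedContinuousFunction (Cn d) ℝ,
      Tendsto (fun N : ℕ => ∫ x, φ x ∂(empiricalMeasure fun k : Fin N => z k)) atTop
        (𝓝 (∫ x, φ x ∂μ))) {g : Cn d → ℝ} (hg : Continuous g) :
    Tendsto (fun N : ℕ => (N : ℝ)⁻¹ * ∑ k : Fin N, g (z k)) atTop (𝓝 (∫ x, g x ∂μ)) := by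
  obtain ⟨B, hB⟩ := hK.exists_bound_of_continuousOn hg.continuousOn
  have hB0 : 0 ≤ B := (norm_nonneg _).trans (hB _ (hz 0))
  -- Clipping g at ±B gives a bounded test function equal to g on K, where μ and all samples live.
  let φ : BoundedContinuousFunction (Cn d) ℝ := BoundedContinuousFunction.ofNormedAddCommGroup
    (fun x => max (-B) (min B (g x))) (by fun_prop) B fun x => by
      rw [Real.norm_eq_abs, abs_le]
      exact ⟨le_max_left _ _, max_le (by linarith) (min_le_left _ _)⟩
  have hφ : ∀ x ∈ K, φ x = g x := fun x hx => by
    have h := abs_le.1 (hB x hx)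
    change max (-B) (min B (g x)) = g x
    rw [min_eq_right h.2, max_eq_right h.1]
  have h := hw φ
  have e1 : ∫ x, φ x ∂μ = ∫ x, g x ∂μ := by
    have : ∀ᵐ x ∂μ, x ∈ K := by rw [ae_iff]; exact hμ
    exact integral_congr_ae (this.mono hφ)
  rw [e1] at h
  refine h.congr fun N => ?_
  rw [empiricalMeasure, integral_smul_measure, integral_finsetSum_measure fun k _ => by
    exact integrable_dirac (by finiteness)]
  simp [hφ _ (hz _)]

lemma tendsto_sum_momentMatrix_sub [IsFiniteMeasure μ] (hK : IsCompact K) (hμ : μ Kᶜ = 0)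
    {z : ℕ → Cn d} (hz : ∀ k, z k ∈ K)
    (hw : ∀ φ : BoundedContinuousFunction (Cn d) ℝ,
      Tendsto (fun N : ℕ => ∫ x, φ x ∂(empiricalMeasure fun k : Fin N => z k)) atTop
        (𝓝 (∫ x, φ x ∂μ))) :
    Tendsto (fun N : ℕ => ∑ q : MultiIndex d n × MultiIndex d n,
      ‖(momentMatrix n (empiricalMeasure fun k : Fin N => z k) - momentMatrix n μ) q.1 q.2‖ ^ 2)
      atTop (𝓝 0) := by
  have h : ∀ q : MultiIndex d n × MultiIndex d n,
      Tendsto (fun N : ℕ => momentMatrix n (empiricalMeasure fun k : Fin N => z k) q.1 q.2) atTop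
        (𝓝 (momentMatrix n μ q.1 q.2)) := fun q => by
    have hc : Continuous fun x : Cn d => conj (monomial x q.1.1) * monomial x q.2.1 :=
      (Complex.continuous_conj.comp (continuous_monomial q.1.1)).mul (continuous_monomial q.2.1)
    have h1 := tendsto_average hK hμ hz hw (Complex.continuous_re.comp hc)
    have h2 := tendsto_average hK hμ hz hw (Complex.continuous_im.comp hc)
    have h3 := ((Complex.continuous_ofReal.tendsto _).comp h1).add
      (((Complex.continuous_ofReal.tendsto _).comp h2).mul_const Complex.I)
    have e := integral_re_add_im (integrable_of_continuous hK hμ hc)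
    simp only [RCLike.re_to_complex, RCLike.im_to_complex, Complex.coe_algebraMap,
      RCLike.I_to_complex] at e
    have e' : momentMatrix n μ q.1 q.2 =
      ∫ x, conj (monomial x q.1.1) * monomial x q.2.1 ∂μ := rfl
    rw [e', ← e]
    refine h3.congr fun N => ?_
    rw [momentMatrix_empirical]
    apply Complex.ext <;> simp
  have h0 : Tendsto (fun N : ℕ => ∑ q : MultiIndex d n × MultiIndex d n,
      ‖(momentMatrix n (empiricalMeasure fun k : Fin N => z k) - momentMatrix n μ) q.1 q.2‖ ^ 2)
      atTop (𝓝 (∑ _q : MultiIndex d n × MultiIndex d n, (0 : ℝ))) := by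
    refine tendsto_finsetSum _ fun q _ => ?_
    have := (((h q).sub_const (momentMatrix n μ q.1 q.2)).norm).pow 2
    simpa using this
  simpa using h0

/-! ### Assembling the bounds -/

lemma sqrt_mul_div_le {S R Λ γ : ℝ} {m n : ℕ} (hR : 0 ≤ R) (hS : S ≤ R ^ (2 * n)) (hγ : 0 < γ)
    (hΛ : 0 < Λ) :
    √(m.factorial : ℝ) * (√S / √(γ * Λ)) ≤ √((m.factorial : ℝ) / γ) * (R ^ n / √Λ) := by
  have h1 : √S ≤ R ^ n := by
    rw [Real.sqrt_le_left (by positivity)]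
    calc S ≤ R ^ (2 * n) := hS
      _ = (R ^ n) ^ 2 := by ring
  rw [Real.sqrt_mul hγ.le, Real.sqrt_div (by positivity)]
  calc √(m.factorial : ℝ) * (√S / (√γ * √Λ)) ≤ √(m.factorial : ℝ) * (R ^ n / (√γ * √Λ)) := by
        gcongr
    _ = _ := by field_simp

lemma average_gauge_le (hK : IsAbsConvexCompactNhd K) {S : Set (Cn d)} (hS : S ⊆ K) {N : ℕ}
    {z : Fin N → Cn d} (hz : ∀ k, z k ∈ S) :
    (N : ℝ)⁻¹ * ∑ k, gauge K (z k) ^ (2 * n) ≤ radius K S ^ (2 * n) := by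
  have hR := hK.radius_nonneg S
  have h : ∑ k, gauge K (z k) ^ (2 * n) ≤ N * radius K S ^ (2 * n) := by
    refine (Finset.sum_le_sum fun k _ =>
      pow_le_pow_left₀ (gauge_nonneg _) (hK.gauge_le_radius hS (hz k)) _).trans_eq ?_
    simp
  rcases Nat.eq_zero_or_pos N with rfl | hN
  · simp only [Nat.cast_zero, inv_zero, zero_mul]
    positivity
  · rw [inv_mul_le_iff₀ (by exact_mod_cast hN)]
    exact h

end Main

end FockRegression

end

theorem theorem5p1 {d r : ℕ}
    (p : Cn d) (hp : ∀ i, (p i).im = 0)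
    (K₀ : Set (Cn d)) (hK₀ : IsAbsConvexCompactNhd K₀)
    (f : Cn d → Cn r) (hf : AnalyticOnNhd ℂ f (translateSet p K₀))
    (K₁ : Set (Cn d)) (hK₁ : IsCompact K₁) (hK₁₀ : K₁ ⊆ interior K₀) :
    -- deterministic bound for arbitrary samples in the support of `μ`
    (∀ (μ : Measure (Cn d)) [IsFiniteMeasure μ], μ K₀ᶜ = 0 → μ.support ⊆ interior K₀ →
      ∃ C : ℝ, 0 < C ∧
        ∀ (m n : ℕ) (hmn : m ≤ n) (N : ℕ) (z : Fin N → Cn d) (γ : ℝ),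
          (∀ k, z k ∈ μ.support) →
          IsUnit (momentMatrix n μ) →
          0 < γ → γ < 1 →
          opNorm (1 - invSqrt (momentMatrix n μ) * momentMatrix n (empiricalMeasure z) *
            invSqrt (momentMatrix n μ)) ≤ 1 - γ →
          uniformError (reconstruction hmn p f (fun k => p + z k)) f (translateSet p K₁) ≤
            ENNReal.ofReal (C *
              (‖f p‖ ^ m / Real.sqrt ((m - 1).factorial : ℝ)
                + Real.sqrt ((m.factorial : ℝ) / γ) *
                    (radius K₀ μ.support ^ n / Real.sqrt (smallestEigenvalue n μ))
                + radius K₀ K₁ ^ m))) ∧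
    -- absolutely continuous sampling distributions on `K₀ ∩ ℝ^d`
    (∀ (ν : Measure (EuclideanSpace ℝ (Fin d))) [IsProbabilityMeasure ν],
      ν ≪ volume → (∀ᵐ x ∂ν, ofRealVec x ∈ K₀) →
      ∀ μ : Measure (Cn d), μ = ν.map ofRealVec →
      ∃ C : ℝ, 0 < C ∧
        -- empirical measures converging weakly to `μ`
        (∀ z : ℕ → Cn d, (∀ k, z k ∈ K₀) →
          (∀ φ : BoundedContinuousFunction (Cn d) ℝ,
            Tendsto (fun N : ℕ => ∫ x, φ x ∂(empiricalMeasure fun k : Fin N => z k)) atTop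
              (𝓝 (∫ x, φ x ∂μ))) →
          ∀ (m n : ℕ) (hmn : m ≤ n),
            limsup (fun N : ℕ => uniformError
                (reconstruction hmn p f (fun k : Fin N => p + z k)) f (translateSet p K₁)) atTop ≤
              ENNReal.ofReal (C *
                (‖f p‖ ^ m / Real.sqrt ((m - 1).factorial : ℝ)
                  + Real.sqrt (m.factorial : ℝ) *
                      (radius K₀ μ.support ^ n / Real.sqrt (smallestEigenvalue n μ))
                  + radius K₀ K₁ ^ m))) ∧
        -- independent samples with law `μ`
        (∀ (m n : ℕ) (hmn : m ≤ n) (N : ℕ) (δ : ℝ), 0 < δ → δ < 1 →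
          coordBound μ ^ (4 * n) * (Fintype.card (MultiIndex d n) : ℝ) ^ 2 /
              smallestEigenvalue n μ ^ 2 * (4 * Real.log (2 / δ)) ≤ (N : ℝ) →
          ∀ (Ω : Type*) [MeasurableSpace Ω] (P : Measure Ω) [IsProbabilityMeasure P]
            (x : Fin N → Ω → Cn d),
            iIndepFun x P → (∀ k, HasLaw (x k) μ P) →
            1 - δ ≤ P.real {ω | uniformError
                (reconstruction hmn p f (fun k => p + x k ω)) f (translateSet p K₁) ≤
              ENNReal.ofReal (C *
                (‖f p‖ ^ m / Real.sqrt ((m - 1).factorial : ℝ)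
                  + Real.sqrt (m.factorial : ℝ) *
                      (radius K₀ μ.support ^ n / Real.sqrt (smallestEigenvalue n μ))
                  + radius K₀ K₁ ^ m))})) := by
  obtain ⟨C, hC, hbound⟩ := exists_uniformError_bound p hK₀ hf (hK₁₀.trans interior_subset)
  -- Nonnegativity is all that is used of this summand: it only enlarges the bound.
  have hT1 : ∀ m : ℕ, 0 ≤ ‖f p‖ ^ m / √((m - 1).factorial : ℝ) := fun m => by positivity
  have hR1 : ∀ m : ℕ, 0 ≤ radius K₀ K₁ ^ m := fun m => pow_nonneg (hK₀.radius_nonneg K₁) m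
  constructor
  · intro μ _ hμ _
    refine ⟨C, hC, fun m n hmn N z γ hz hu hγ _ hop => ?_⟩
    have hpd := posDef_of_isUnit hK₀.isCompact hμ hu
    have hΛ := smallestEigenvalue_pos hpd
    have hst : IsStableSample n z (γ * smallestEigenvalue n μ) :=
      isStableSample_of_quadForm fun v => by
        have h1 := smallestEigenvalue_mul_le n μ v
        have h2 := quadForm_le_of_opNorm_one_sub hpd hop v
        rw [mul_assoc]
        exact (mul_le_mul_of_nonneg_left h1 hγ.le).trans h2
    have hS := support_subset hK₀.isCompact hμ
    refine (hbound m n hmn N z _ (fun k => hS (hz k)) (mul_pos hγ hΛ) hst).trans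
      (ENNReal.ofReal_le_ofReal (mul_le_mul_of_nonneg_left ?_ hC.le))
    have h3 := sqrt_mul_div_le (m := m) (hK₀.radius_nonneg μ.support)
      (average_gauge_le (n := n) hK₀ hS hz) hγ hΛ
    linarith [hT1 m]
  · intro ν _ hν hνK μ hμν
    have hm : Measurable (ofRealVec (d := d)) := continuous_ofRealVec.measurable
    have hμ : μ K₀ᶜ = 0 := by
      rw [hμν, Measure.map_apply hm hK₀.isCompact.measurableSet.compl]
      exact hνK
    have : IsProbabilityMeasure μ := by
      rw [hμν]
      exact Measure.isProbabilityMeasure_map hm.aemeasurable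
    have hσ : relativeMean μ < 1 := by
      rw [hμν] at hμ ⊢
      exact relativeMean_lt_one hν hK₀.isCompact hμ
    have hΛ : ∀ n, 0 < smallestEigenvalue n μ := fun n => by
      rw [hμν] at hμ ⊢
      exact smallestEigenvalue_pos (posDef_of_absolutelyContinuous hν hK₀.isCompact hμ n)
    have hS := support_subset hK₀.isCompact hμ
    have hSR := hK₀.radius_nonneg μ.support
    -- Since √(1/γ) ≥ 1 can be pulled out of all three summands, a stability factor γ independent of
    -- m and n is absorbed by the constant.
    have hconst : ∀ (γ : ℝ), 0 < γ → γ ≤ 1 → ∀ (m n : ℕ) (S : ℝ),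
        S ≤ radius K₀ μ.support ^ (2 * n) →
        C * (√(m.factorial : ℝ) * (√S / √(γ * smallestEigenvalue n μ)) + radius K₀ K₁ ^ m) ≤
          C * √γ⁻¹ * (‖f p‖ ^ m / √((m - 1).factorial : ℝ) + √(m.factorial : ℝ) *
            (radius K₀ μ.support ^ n / √(smallestEigenvalue n μ)) + radius K₀ K₁ ^ m) := by
      intro γ hγ hγ1 m n S hSn
      rw [mul_assoc]
      refine mul_le_mul_of_nonneg_left ?_ hC.le
      have h3 := sqrt_mul_div_le (m := m) hSR hSn hγ (hΛ n)
      rw [div_eq_mul_inv (m.factorial : ℝ), Real.sqrt_mul (Nat.cast_nonneg m.factorial)] at h3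
      have h4 : 1 ≤ √γ⁻¹ := Real.one_le_sqrt.2 ((one_le_inv₀ hγ).2 hγ1)
      have h5 := mul_nonneg (Real.sqrt_nonneg γ⁻¹) (hT1 m)
      have h6 := le_mul_of_one_le_left (hR1 m) h4
      linarith
    have hstab := stabilityConst_pos hσ
    -- A belongs to weak convergence with γ = 1/2, B to random samples with γ = `stabilityConst μ`;
    -- the sum serves both.
    set A := C * √(2⁻¹ : ℝ)⁻¹ with hA
    set B := C * √(stabilityConst μ)⁻¹ with hB
    have hA0 : 0 < A := by positivity
    have hB0 : 0 < B := by positivity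
    have hD0 : ∀ m n, 0 ≤ ‖f p‖ ^ m / √((m - 1).factorial : ℝ) + √(m.factorial : ℝ) *
        (radius K₀ μ.support ^ n / √(smallestEigenvalue n μ)) + radius K₀ K₁ ^ m := fun m n =>
      add_nonneg (add_nonneg (hT1 m) (by positivity)) (hR1 m)
    refine ⟨A + B, by positivity, fun z hz hw m n hmn => ?_, ?_⟩
    -- The samples may lie outside the support of μ, but the mean of their gauges to the power 2n
    -- tends to S, which is at most R_μ^{2n}.
    · set S := ∫ x, gauge K₀ x ^ (2 * n) ∂μ with hSdef
      have hgc : Continuous fun x => gauge K₀ x ^ (2 * n) := hK₀.continuous_gauge.pow _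
      have hav := tendsto_average hK₀.isCompact hμ hz hw hgc
      have hfro := tendsto_sum_momentMatrix_sub (n := n) hK₀.isCompact hμ hz hw
      have hev : ∀ᶠ N : ℕ in atTop, uniformError
          (reconstruction hmn p f (fun k : Fin N => p + z k)) f (translateSet p K₁) ≤
          ENNReal.ofReal (C * (√(m.factorial : ℝ) *
            (√((N : ℝ)⁻¹ * ∑ k : Fin N, gauge K₀ (z k) ^ (2 * n)) /
              √(2⁻¹ * smallestEigenvalue n μ)) + radius K₀ K₁ ^ m)) := by
        have hpos : (0 : ℝ) < ((1 - 2⁻¹) * smallestEigenvalue n μ) ^ 2 :=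
          pow_pos (mul_pos (by norm_num) (hΛ n)) 2
        filter_upwards [hfro.eventually_le_const hpos] with N hN
        exact hbound m n hmn N (fun k => z k) _ (fun k => hz k)
          (mul_pos (by norm_num) (hΛ n))
          (isStableSample_of_frobenius (by norm_num) (hΛ n).le hN)
      have hlim : Tendsto (fun N : ℕ => ENNReal.ofReal (C * (√(m.factorial : ℝ) *
            (√((N : ℝ)⁻¹ * ∑ k : Fin N, gauge K₀ (z k) ^ (2 * n)) /
              √(2⁻¹ * smallestEigenvalue n μ)) + radius K₀ K₁ ^ m))) atTop
          (𝓝 (ENNReal.ofReal (C * (√(m.factorial : ℝ) *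
            (√S / √(2⁻¹ * smallestEigenvalue n μ)) + radius K₀ K₁ ^ m)))) :=
        ENNReal.tendsto_ofReal ((((hav.sqrt.div_const _).const_mul _).add_const _).const_mul _)
      refine (limsup_le_limsup hev).trans (hlim.limsup_eq.trans_le (ENNReal.ofReal_le_ofReal ?_))
      have hSle : S ≤ radius K₀ μ.support ^ (2 * n) := by
        have h1 : ∀ᵐ x ∂μ, gauge K₀ x ^ (2 * n) ≤ radius K₀ μ.support ^ (2 * n) := by
          filter_upwards [Measure.support_mem_ae (μ := μ)] with x hx
          exact pow_le_pow_left₀ (gauge_nonneg x) (hK₀.gauge_le_radius hS hx) _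
        have h2 := integral_mono_ae (integrable_of_continuous hK₀.isCompact hμ hgc)
          (integrable_const _) h1
        simpa using h2
      refine (hconst 2⁻¹ (by norm_num) (by norm_num) m n S hSle).trans ?_
      exact mul_le_mul_of_nonneg_right (le_add_of_nonneg_right hB0.le) (hD0 m n)
    · intro m n hmn N δ hδ hδ1 hN Ω _ P _ x hind hx
      have hbad := measure_isStableSample hK₀.isCompact hμ hσ (hΛ n) hδ hδ1 hN hind hx
      have hsupp : ∀ᵐ ω ∂P, ∀ k, x k ω ∈ μ.support := by
        rw [ae_all_iff]
        intro k
        refine ae_of_ae_map (hx k).aemeasurable ?_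
        rw [(hx k).map_eq]
        exact Measure.support_mem_ae
      set good := {ω | uniformError
        (reconstruction hmn p f (fun k => p + x k ω)) f (translateSet p K₁) ≤
          ENNReal.ofReal ((A + B) *
            (‖f p‖ ^ m / Real.sqrt ((m - 1).factorial : ℝ)
              + Real.sqrt (m.factorial : ℝ) *
                  (radius K₀ μ.support ^ n / Real.sqrt (smallestEigenvalue n μ))
              + radius K₀ K₁ ^ m))} with hgood
      set bad := {ω | ¬ IsStableSample n (fun k => x k ω)
        (stabilityConst μ * smallestEigenvalue n μ)} with hbadD
      have hcover : ∀ᵐ ω ∂P, ω ∈ good ∪ bad := by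
        filter_upwards [hsupp] with ω hω
        by_cases hst : IsStableSample n (fun k => x k ω)
          (stabilityConst μ * smallestEigenvalue n μ)
        · left
          refine (hbound m n hmn N _ _ (fun k => hS (hω k)) (mul_pos hstab (hΛ n)) hst).trans
            (ENNReal.ofReal_le_ofReal ?_)
          refine (hconst _ hstab (stabilityConst_le_one μ) m n _
            (average_gauge_le (n := n) hK₀ hS hω)).trans ?_
          exact mul_le_mul_of_nonneg_right (le_add_of_nonneg_left hA0.le) (hD0 m n)
        · exact Or.inr hst
      -- Almost sure covering and subadditivity give P(good) ≥ 1 - δ without measurability of either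
      -- event.
      have h1 : P.real (good ∪ bad) = 1 := by
        have h : P (good ∪ bad) = 1 :=
          (measure_congr (eventuallyEq_univ.2 hcover)).trans measure_univ
        rw [measureReal_def, h, ENNReal.toReal_one]
      have h2 := measureReal_union_le (μ := P) good bad
      linarith
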